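/- **Theorem 2.7 (non-ergodicity).** Let $G=(V,E)$ be an infinite connected simple graph with bounded degrees; put $\Delta=\sup_x\deg(x)$, $\delta=\inf_x\deg(x)$, and $$\Phi_E=\inf_K\frac{|\partial_E K|}{|K|},\qquad \Phi_V=\inf_K\frac{|\partial_V K|}{|K|},$$ the infima being over finite nonempty $K\subset V$, where $\partial_E K$ is the set of edges with exactly one endpoint in $K$ and $\partial_V K$ is the set of vertices outside $K$ having a neighbour in $K$. An integer $j$ with $1\le j\le\delta$ is called $\chi$-good if at least one of the following holds: (i) $2j<3\Phi_E-\Delta+2$; (ii) $G$ is bipartite and $j<\Phi_E+1$; (iii) $j<\Phi_V$; (iv) $G$ is the $d$-regular tree for some $d\ge2$, and $j<d$. Let $(L_x(t))_{x\in V,\,t\ge1}$ be i.i.d. uniform on $[0,1]$, let $\varepsilon\ge0$, and for $\eta\in\{0,1\}^V$ let $c_x(\eta)$ be the number of neighbours $y$ of $x$ with $\eta_y=1$. The $j$-threshold Consensus Process $\chi$ with $\varepsilon$-noise is the discrete-time Markov process on $\{0,1\}^V$ given by $$\chi_x(t)=\begin{cases}\mathbf 1\{c_x(\chi(t-1))\ge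 j\}&\text{if }L_x(t)\ge\varepsilon,\\0&\text{if }L_x(t)<\varepsilon.\end{cases}$$ The $\varepsilon$-noise Majority Vote Process $\sigma$ is given by $\sigma_x(t)=0$ if $L_x(t)<\varepsilon/2$; $\sigma_x(t)=1$ if $\varepsilon/2\le L_x(t)<\varepsilon$; and, if $L_x(t)\ge\varepsilon$, $\sigma_x(t)=0$, $1$ or $\sigma_x(t-1)$ according to whether $c_x(\sigma(t-1))$ is less than, greater than or equal to $\deg(x)/2$. A superscript $\mathbf 1$ denotes the process started from the configuration identically equal to $1$. (a) If $j$ is $\chi$-good, then there is $\varepsilon_0>0$ such that for every $\varepsilon\in[0,\varepsilon_0]$ the process $\chi$ has at least two distinct invariant probability measures, and there is $0<c<\frac12$ such that $\mathbb P[\chi^{\mathbf 1}_x(t)=0]\le c$ for every $t\ge1$ and every $x\in V$. (b) If $\lfloor\Delta/2+1\rfloor$ is $\chi$-good, then there is $\varepsilon_0>0$ such that for every $\varepsilon\in[0,\varepsilon_0]$ the process $\sigma$ has at least two distinct invariant probability measures, and there is $0<c<\frac12$ such that $\mathbb P[\sigma^{\mathbf 1}_x(t)=0]\le c$ for every $t\ge1$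 and every $x\in V$. -/

import Mathlib

open MeasureTheory ProbabilityTheory
open scoped unitInterval

noncomputable section

namespace NoisyDynamics

/-- Configurations `η ∈ {0, 1}^V`; the state `1` is `true` and the state `0` is `false`.
Carries the product `σ`-algebra. -/
abbrev Config (V : Type*) := V → Bool

/-! ## Degrees and expansion constants -/

section Graph

variable {V : Type*} (G : SimpleGraph V)

/-- `Δ(G)`, the supremum of the degrees (used for graphs with bounded degrees only). -/
def supDegree [G.LocallyFinite] : ℕ := ⨆ x, G.degree x

/-- `δ(G)`, the infimum of the degrees. -/
def infDegree [G.LocallyFinite] : ℕ := ⨅ x, G.degree x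

/-- The edges of `G` with exactly one endpoint in `K`. -/
def edgeBdry (K : Finset V) : Set (Sym2 V) :=
  {e | e ∈ G.edgeSet ∧ ∃ x ∈ K, ∃ y ∉ K, e = s(x, y)}

/-- The vertices outside `K` with a neighbour in `K`. -/
def vertexBdry (K : Finset V) : Set V :=
  {x | x ∉ K ∧ ∃ y ∈ K, G.Adj x y}

/-- The edge expansion constant `Φ_E(G)`: infimum of `|∂_E K| / |K|` over finite nonempty `K`. -/
def edgeExpansion : ℝ :=
  ⨅ K : {K : Finset V // K.Nonempty}, ((edgeBdry G K.1).ncard : ℝ) / (K.1.card : ℝ)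

/-- The vertex expansion constant `Φ_V(G)`: infimum of `|∂_V K| / |K|` over finite nonempty `K`. -/
def vertexExpansion : ℝ :=
  ⨅ K : {K : Finset V // K.Nonempty}, ((vertexBdry G K.1).ncard : ℝ) / (K.1.card : ℝ)

/-- `j` is `χ`-good: `1 ≤ j ≤ δ(G)` and at least one of the following holds:
* `2j < 3 Φ_E - Δ + 2`;
* `G` is bipartite and `j < Φ_E + 1`;
* `j < Φ_V`;
* `G` is the `d`-regular tree for some `d ≥ 2`, and `j < d`. -/
def ChiGood [G.LocallyFinite] (j : ℕ) : Prop :=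
  1 ≤ j ∧ j ≤ infDegree G ∧
    (2 * (j : ℝ) < 3 * edgeExpansion G - (supDegree G : ℝ) + 2 ∨
      (G.IsBipartite ∧ (j : ℝ) < edgeExpansion G + 1) ∨
      (j : ℝ) < vertexExpansion G ∨
      ∃ d : ℕ, 2 ≤ d ∧ G.IsTree ∧ G.IsRegularOfDegree d ∧ j < d)

end Graph

/-! ## Noise

`(u_x)_{x ∈ V}` are i.i.d. uniform on `[0, 1]`, and so are `(L_x(t))`, indexed by `(t, x)`.
The variables at time `0` are never used. -/

/-- The law of the i.i.d. uniform variables used in a single time step. -/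
def stepNoiseLaw (V : Type*) : Measure (V → I) :=
  Measure.infinitePi fun _ : V => (volume : Measure I)

/-- The law of the i.i.d. uniform variables `L_x(t)`, indexed by pairs `(t, x)`. -/
def noiseLaw (V : Type*) : Measure (ℕ × V → I) :=
  Measure.infinitePi fun _ : ℕ × V => (volume : Measure I)

instance (V : Type*) : IsProbabilityMeasure (stepNoiseLaw V) := by
  unfold stepNoiseLaw; infer_instance

instance (V : Type*) : IsProbabilityMeasure (noiseLaw V) := by
  unfold noiseLaw; infer_instance

/-! ## The two dynamics -/

section Dynamics

variable {V : Type*} (G : SimpleGraph V) [G.LocallyFinite]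

/-- `c_x(η)`, the number of neighbours of `x` in state `1`. -/
def onesAround (η : Config V) (x : V) : ℕ :=
  ((G.neighborFinset x).filter fun y => η y = true).card

/-- One step of the `j`-threshold Consensus Process with `ε`-noise, from `η` with noise `u`. -/
def consensusStep (j : ℕ) (ε : ℝ) (η : Config V) (u : V → I) : Config V := fun x =>
  if (u x : ℝ) < ε then false
  else if j ≤ onesAround G η x then true else false

/-- One step of the `ε`-noise Majority Vote Process, from `η` with noise `u`. -/
def majorityStep (ε : ℝ) (η : Config V) (u : V → I) : Config V := fun x =>
  if (u x : ℝ) < ε / 2 then false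
  else if (u x : ℝ) < ε then true
  else if (onesAround G η x : ℝ) < (G.degree x : ℝ) / 2 then false
  else if (G.degree x : ℝ) / 2 < (onesAround G η x : ℝ) then true
  else η x

/-- `χ^ξ(t)`: the Consensus Process started at `ξ`, as a function of the noise `L`. -/
def consensus (j : ℕ) (ε : ℝ) (ξ : Config V) (L : ℕ × V → I) : ℕ → Config V
  | 0 => ξ
  | t + 1 => consensusStep G j ε (consensus j ε ξ L t) fun x => L (t + 1, x)

/-- `σ^ξ(t)`: the Majority Vote Process started at `ξ`, as a function of the noise `L`. -/
def majority (ε : ℝ) (ξ : Config V) (L : ℕ × V → I) : ℕ → Config V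
  | 0 => ξ
  | t + 1 => majorityStep G ε (majority ε ξ L t) fun x => L (t + 1, x)

theorem measurable_onesAround (x : V) : Measurable fun η : Config V => onesAround G η x := by
  have h : (fun η : Config V => onesAround G η x) =
      fun η => ∑ y ∈ G.neighborFinset x, (if η y = true then 1 else 0) := by
    funext η
    exact Finset.card_filter _ _
  rw [h]
  refine Finset.measurable_fun_sum _ fun y _ => ?_
  exact (measurable_of_countable fun b : Bool => if b = true then (1 : ℕ) else 0).comp
    (measurable_pi_apply y)

theorem measurable_consensusStep (j : ℕ) (ε : ℝ) :
    Measurable fun p : Config V × (V → I) => consensusStep G j ε p.1 p.2 := by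
  refine measurable_pi_iff.2 fun x => ?_
  have hu : Measurable fun p : Config V × (V → I) => ((p.2 x : I) : ℝ) :=
    measurable_subtype_coe.comp ((measurable_pi_apply x).comp measurable_snd)
  have hc : Measurable fun p : Config V × (V → I) => onesAround G p.1 x :=
    (measurable_onesAround G x).comp measurable_fst
  unfold consensusStep
  exact Measurable.ite (measurableSet_lt hu measurable_const) measurable_const
    (Measurable.ite (measurableSet_le measurable_const hc) measurable_const measurable_const)

theorem measurable_majorityStep (ε : ℝ) :
    Measurable fun p : Config V × (V → I) => majorityStep G ε p.1 p.2 := by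
  refine measurable_pi_iff.2 fun x => ?_
  have hu : Measurable fun p : Config V × (V → I) => ((p.2 x : I) : ℝ) :=
    measurable_subtype_coe.comp ((measurable_pi_apply x).comp measurable_snd)
  have hc : Measurable fun p : Config V × (V → I) => (onesAround G p.1 x : ℝ) :=
    (measurable_of_countable fun n : ℕ => (n : ℝ)).comp
      ((measurable_onesAround G x).comp measurable_fst)
  have hη : Measurable fun p : Config V × (V → I) => p.1 x :=
    (measurable_pi_apply x).comp measurable_fst
  unfold majorityStep
  exact Measurable.ite (measurableSet_lt hu measurable_const) measurable_const
    (Measurable.ite (measurableSet_lt hu measurable_const) measurable_const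
      (Measurable.ite (measurableSet_lt hc measurable_const) measurable_const
        (Measurable.ite (measurableSet_lt measurable_const hc) measurable_const hη)))

/-- The transition kernel of the Consensus Process: from `η`, the law of one step. -/
def consensusKernel (j : ℕ) (ε : ℝ) : Kernel (Config V) (Config V) where
  toFun η := (stepNoiseLaw V).map fun u => consensusStep G j ε η u
  measurable' := by
    refine Measure.measurable_of_measurable_coe _ fun s hs => ?_
    have h : ∀ η : Config V, (stepNoiseLaw V).map (fun u => consensusStep G j ε η u) s =
        stepNoiseLaw V (Prod.mk η ⁻¹'
          ((fun p : Config V × (V → I) => consensusStep G j ε p.1 p.2) ⁻¹' s)) := fun η =>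
      Measure.map_apply ((measurable_consensusStep G j ε).comp measurable_prodMk_left) hs
    simp only [h]
    exact measurable_measure_prodMk_left (measurable_consensusStep G j ε hs)

/-- The transition kernel of the Majority Vote Process: from `η`, the law of one step. -/
def majorityKernel (ε : ℝ) : Kernel (Config V) (Config V) where
  toFun η := (stepNoiseLaw V).map fun u => majorityStep G ε η u
  measurable' := by
    refine Measure.measurable_of_measurable_coe _ fun s hs => ?_
    have h : ∀ η : Config V, (stepNoiseLaw V).map (fun u => majorityStep G ε η u) s =
        stepNoiseLaw V (Prod.mk η ⁻¹'
          ((fun p : Config V × (V → I) => majorityStep G ε p.1 p.2) ⁻¹' s)) := fun η =>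
      Measure.map_apply ((measurable_majorityStep G ε).comp measurable_prodMk_left) hs
    simp only [h]
    exact measurable_measure_prodMk_left (measurable_majorityStep G ε hs)

end Dynamics

/-- The Markov chain with transition kernel `κ` has at least two invariant probability measures. -/
def HasMultipleInvariantMeasures {S : Type*} [MeasurableSpace S] (κ : Kernel S S) : Prop :=
  ∃ μ ν : Measure S, IsProbabilityMeasure μ ∧ IsProbabilityMeasure ν ∧
    κ.Invariant μ ∧ κ.Invariant ν ∧ μ ≠ ν

end NoisyDynamics

end

/-! The proof is a Peierls argument. Start from all ones and let `B` be the random set of space-time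
points with noise below `ε`. A zero outside `B` has fewer than `j` ones around it one step earlier,
hence at least `deg - j + 1` neighbouring zeros there. Traced backwards, a zero at `(t, x)`
therefore generates a cluster of zeros, which must be extinct at time `0`. Goodness of `j` makes
such clusters grow except at points of `B`, so extinction forces a fixed proportion of noisy points.
This is recorded as a space-time walk from `(t, x)` with at least `1/k` of its vertices, counted
with multiplicity, matched by distinct noisy points (`HasNoisyWalk`). The number of walks of length
`n` is exponential in `n`, whereas the required noise has probability `ε` to a power proportional to
`n`; for small `ε` the sum is at most `1/4`.

Growth is measured by a potential: the size of the levels under vertex expansion, and the number of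
edges between consecutive levels under edge expansion (`hasNoisyWalk_of_potential`). On trees,
induction on time bounds the length of a walk between two linked zeros, plus their distance, by the
number of noisy points it visits (`hasNoisyPassage_of_reachable`).

Both dynamics are monotone and local, so running them from all ones at time `-n` gives
configurations at time `0` that decrease in `n`. The law of their limit is invariant and inherits
the bound `1/4` on zeros. A second invariant law charges zeros heavily: the point mass at all zeros
for consensus, and the law obtained by exchanging the two states for majority. -/

noncomputable section

namespace NoisyDynamics

/-! ## A union bound over walks -/

section Peierls

variable {W : Type*}

open Classical in
/-- The vertex sets of the walks of length `n` from `u` whose steps go along `nb`. -/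
def walkSets (nb : W → Finset W) : ℕ → W → Finset (Finset W)
  | 0, u => {{u}}
  | n + 1, u => (nb u).biUnion fun v => (walkSets nb n v).image (insert u)

theorem card_walkSets_le (nb : W → Finset W) {D : ℕ} (hD : ∀ u, (nb u).card ≤ D) (n : ℕ) (u : W) :
    (walkSets nb n u).card ≤ D ^ n := by
  classical
  induction n generalizing u with
  | zero => simp [walkSets]
  | succ n ih =>
    rw [walkSets, pow_succ']
    refine (Finset.card_biUnion_le_card_mul _ _ (D ^ n) fun v _ => ?_).trans
      (Nat.mul_le_mul_right _ (hD u))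
    exact Finset.card_image_le.trans (ih v)

theorem card_le_of_mem_walkSets (nb : W → Finset W) (n : ℕ) (u : W) (S : Finset W)
    (hS : S ∈ walkSets nb n u) : S.card ≤ n + 1 := by
  classical
  induction n generalizing u S with
  | zero =>
    simp only [walkSets, Finset.mem_singleton] at hS
    simp [hS]
  | succ n ih =>
    simp only [walkSets, Finset.mem_biUnion, Finset.mem_image] at hS
    obtain ⟨v, -, T, hT, rfl⟩ := hS
    exact (Finset.card_insert_le _ _).trans (Nat.succ_le_succ (ih v T hT))

open Classical in
theorem support_mem_walkSets {H : SimpleGraph W} (nb : W → Finset W)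
    (hnb : ∀ u v, H.Adj u v → v ∈ nb u) {u v : W} (w : H.Walk u v) :
    w.support.toFinset ∈ walkSets nb w.length u := by
  induction w with
  | nil => simp [walkSets]
  | cons h p ih =>
    simp only [SimpleGraph.Walk.length_cons, walkSets, Finset.mem_biUnion, Finset.mem_image]
    exact ⟨_, hnb _ _ h, _, ih, by simp⟩

/-- A walk from `u` along which a fixed proportion of the vertices visited lies in `B`. -/
def HasNoisyWalk (H : SimpleGraph W) (k : ℕ) (B : Set W) (u : W) : Prop :=
  ∃ (v : W) (w : H.Walk u v) (S : Finset W), (∀ a ∈ S, a ∈ B) ∧ (∀ a ∈ S, a ∈ w.support) ∧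
    w.length + 1 ≤ k * S.card

/-- Union bound over the length `n`, the set `T` visited and the noisy subset `S` of `T`. There are
at most `(D + 1) ^ (n + 1)` choices of `T` and `2 ^ (n + 1)` of `S`, and `n + 1 ≤ k * S.card` turns
the noise cost into at most `δ ^ (n + 1)`. Counting sets instead of walks suffices because the noise
event depends on `S` only. -/
theorem measure_hasNoisyWalk_le {Ω : Type*} [MeasurableSpace Ω] (P : Measure Ω)
    {H : SimpleGraph W} (nb : W → Finset W) (hnb : ∀ u v, H.Adj u v → v ∈ nb u)
    {D : ℕ} (hD : ∀ u, (nb u).card ≤ D) {k : ℕ} {δ : ENNReal} (hδ : δ ≤ 1)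
    (B : Ω → Set W) (hB : ∀ S : Finset W, P {ω | ∀ a ∈ S, a ∈ B ω} ≤ (δ ^ k) ^ S.card) (u : W) :
    P {ω | HasNoisyWalk H k (B ω) u} ≤ ∑' n : ℕ, (2 * (D + 1) * δ) ^ (n + 1) := by
  classical
  have hsub : {ω | HasNoisyWalk H k (B ω) u} ⊆ ⋃ n : ℕ, ⋃ T ∈ walkSets nb n u,
      ⋃ S ∈ T.powerset.filter (fun S => n + 1 ≤ k * S.card), {ω | ∀ a ∈ S, a ∈ B ω} := by
    rintro ω ⟨v, w, S, hSB, hSw, hlen⟩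
    simp only [Set.mem_iUnion]
    refine ⟨w.length, w.support.toFinset, support_mem_walkSets nb hnb w, S, ?_, hSB⟩
    simp only [Finset.mem_filter, Finset.mem_powerset]
    exact ⟨fun a ha => List.mem_toFinset.2 (hSw a ha), hlen⟩
  refine (measure_mono hsub).trans ((measure_iUnion_le _).trans (ENNReal.tsum_le_tsum fun n => ?_))
  calc P (⋃ T ∈ walkSets nb n u, ⋃ S ∈ T.powerset.filter (fun S => n + 1 ≤ k * S.card),
          {ω | ∀ a ∈ S, a ∈ B ω})
      ≤ ∑ T ∈ walkSets nb n u, P (⋃ S ∈ T.powerset.filter (fun S => n + 1 ≤ k * S.card),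
          {ω | ∀ a ∈ S, a ∈ B ω}) := measure_biUnion_finset_le _ _
    _ ≤ ∑ T ∈ walkSets nb n u, (2 : ENNReal) ^ (n + 1) * δ ^ (n + 1) := by
        refine Finset.sum_le_sum fun T hT => ?_
        refine (measure_biUnion_finset_le _ _).trans ?_
        calc ∑ S ∈ T.powerset.filter (fun S => n + 1 ≤ k * S.card), P {ω | ∀ a ∈ S, a ∈ B ω}
            ≤ ∑ S ∈ T.powerset.filter (fun S => n + 1 ≤ k * S.card), δ ^ (n + 1) := by
              refine Finset.sum_le_sum fun S hS => (hB S).trans ?_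
              rw [← pow_mul]
              exact pow_le_pow_right_of_le_one' hδ (Finset.mem_filter.1 hS).2
          _ ≤ (2 : ENNReal) ^ (n + 1) * δ ^ (n + 1) := by
              rw [Finset.sum_const, nsmul_eq_mul]
              refine mul_le_mul_left ?_ _
              have h1 : (T.powerset.filter (fun S => n + 1 ≤ k * S.card)).card ≤ 2 ^ (n + 1) := by
                refine (Finset.card_filter_le _ _).trans ?_
                rw [Finset.card_powerset]
                exact Nat.pow_le_pow_right (by norm_num) (card_le_of_mem_walkSets nb n u T hT)
              exact_mod_cast h1
    _ ≤ (2 * (D + 1) * δ) ^ (n + 1) := by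
        rw [Finset.sum_const, nsmul_eq_mul, mul_pow, mul_pow, ← mul_assoc,
          mul_comm ((walkSets nb n u).card : ENNReal)]
        refine mul_le_mul_left (mul_le_mul_right ?_ _) _
        have h1 : (walkSets nb n u).card ≤ (D + 1) ^ (n + 1) :=
          (card_walkSets_le nb hD n u).trans
            ((Nat.pow_le_pow_left (Nat.le_succ D) n).trans
              (Nat.pow_le_pow_right (Nat.succ_pos D) (Nat.le_succ n)))
        exact_mod_cast h1

theorem tsum_pow_succ_le_quarter {r : ENNReal} (hr : r ≤ 1 / 5) :
    ∑' n : ℕ, r ^ (n + 1) ≤ 1 / 4 := by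
  have h5 : (1 : ENNReal) / 5 = ENNReal.ofReal (1 / 5) := by
    rw [ENNReal.ofReal_div_of_pos (by norm_num)]; norm_num
  calc ∑' n : ℕ, r ^ (n + 1) ≤ ∑' n : ℕ, (1 / 5 : ENNReal) ^ (n + 1) :=
        ENNReal.tsum_le_tsum fun n => pow_le_pow_left' hr _
    _ = (1 / 5) * (1 - 1 / 5)⁻¹ := by
        simp_rw [pow_succ']
        rw [ENNReal.tsum_mul_left, ENNReal.tsum_geometric]
    _ ≤ 1 / 4 := by
        have h1 : (1 : ENNReal) - 1 / 5 = ENNReal.ofReal (4 / 5) := by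
          rw [h5, ← ENNReal.ofReal_one, ← ENNReal.ofReal_sub _ (by norm_num)]; norm_num
        have h4 : (1 : ENNReal) / 4 = ENNReal.ofReal (1 / 4) := by
          rw [ENNReal.ofReal_div_of_pos (by norm_num)]; norm_num
        rw [h1, h5, h4, ← ENNReal.ofReal_inv_of_pos (by norm_num), ← ENNReal.ofReal_mul (by norm_num)]
        exact ENNReal.ofReal_le_ofReal (by norm_num)

/-- If every vertex belongs to the random set independently with probability at most `ε`, then
noisy walks from a given vertex are unlikely once `ε` is small. -/
theorem exists_measure_hasNoisyWalk_le_quarter (D k : ℕ) : ∃ ε₀ : ℝ, 0 < ε₀ ∧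
    ∀ {W : Type*} {Ω : Type*} [MeasurableSpace Ω] (P : Measure Ω) (H : SimpleGraph W)
      (nb : W → Finset W), (∀ u v, H.Adj u v → v ∈ nb u) → (∀ u, (nb u).card ≤ D) →
      ∀ (B : Ω → Set W) (ε : ℝ), ε ≤ ε₀ →
      (∀ S : Finset W, P {ω | ∀ a ∈ S, a ∈ B ω} ≤ ENNReal.ofReal ε ^ S.card) →
      ∀ u : W, P {ω | HasNoisyWalk H k (B ω) u} ≤ 1 / 4 := by
  -- This choice makes the ratio `2 * (D + 1) * d` equal to `1/5`, so the geometric series sums to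
  -- `1/4`; the noise level is then `d ^ k`.
  set d : ℝ := 1 / (10 * (D + 1)) with hd
  have hd0 : 0 < d := by positivity
  have hd1 : d ≤ 1 := by
    rw [hd, div_le_one (by positivity)]
    have : (0 : ℝ) ≤ D := Nat.cast_nonneg D
    linarith
  refine ⟨d ^ k, by positivity, ?_⟩
  intro W Ω _ P H nb hnb hD B ε hε hB u
  refine (measure_hasNoisyWalk_le P nb hnb hD (k := k) (δ := ENNReal.ofReal d) ?_ B ?_ u).trans
    (tsum_pow_succ_le_quarter ?_)
  · exact ENNReal.ofReal_le_one.2 hd1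
  · intro S
    refine (hB S).trans (pow_le_pow_left' ?_ _)
    rw [← ENNReal.ofReal_pow hd0.le]
    exact ENNReal.ofReal_le_ofReal hε
  · have h5 : (1 : ENNReal) / 5 = ENNReal.ofReal (1 / 5) := by
      rw [ENNReal.ofReal_div_of_pos (by norm_num)]; norm_num
    have h2 : (2 * ((D : ENNReal) + 1)) = ENNReal.ofReal (2 * (D + 1)) := by
      rw [ENNReal.ofReal_mul (by norm_num), ENNReal.ofReal_add (by positivity) (by norm_num)]
      simp
    rw [h5, h2, ← ENNReal.ofReal_mul (by positivity)]
    refine ENNReal.ofReal_le_ofReal (le_of_eq ?_)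
    rw [hd]; field_simp; norm_num

end Peierls

/-! ## The space-time graph -/

section SpaceTime

variable {V : Type*} (G : SimpleGraph V)

/-- Space-time points at consecutive times are adjacent if their space coordinates are. -/
def spaceTime : SimpleGraph (ℕ × V) where
  Adj a b := G.Adj a.2 b.2 ∧ (a.1 = b.1 + 1 ∨ b.1 = a.1 + 1)
  symm := ⟨fun _ _ h => ⟨h.1.symm, h.2.symm⟩⟩
  loopless := ⟨fun _ h => G.loopless.irrefl _ h.1⟩

open Classical in
/-- A finite set of space-time points containing the neighbours of `a`. -/
def spaceTimeNbrs [G.LocallyFinite] (a : ℕ × V) : Finset (ℕ × V) :=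
  (G.neighborFinset a.2).image (fun y => (a.1 + 1, y)) ∪
    (G.neighborFinset a.2).image (fun y => (a.1 - 1, y))

theorem mem_spaceTimeNbrs [G.LocallyFinite] (a b : ℕ × V) (h : (spaceTime G).Adj a b) :
    b ∈ spaceTimeNbrs G a := by
  obtain ⟨h1, h2⟩ := h
  simp only [spaceTimeNbrs, Finset.mem_union, Finset.mem_image, SimpleGraph.mem_neighborFinset]
  rcases h2 with h2 | h2
  · exact Or.inr ⟨b.2, h1, Prod.ext (by simp [h2]) rfl⟩
  · exact Or.inl ⟨b.2, h1, Prod.ext (by simp [h2]) rfl⟩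

theorem card_spaceTimeNbrs_le [G.LocallyFinite] {D : ℕ} (hD : ∀ x, G.degree x ≤ D) (a : ℕ × V) :
    (spaceTimeNbrs G a).card ≤ 2 * D := by
  classical
  refine (Finset.card_union_le _ _).trans ?_
  rw [two_mul]
  exact add_le_add (Finset.card_image_le.trans (hD _)) (Finset.card_image_le.trans (hD _))

/-- `η` starts from all ones, and up to time `t` every zero outside `B` has fewer than `j` ones
around it one step earlier. -/
def ZeroRule [G.LocallyFinite] (j t : ℕ) (η : ℕ → Config V) (B : Set (ℕ × V)) : Prop :=
  (∀ x, η 0 x = true) ∧ ∀ s < t, ∀ x, η (s + 1) x = false →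
    (s + 1, x) ∈ B ∨ onesAround G (η s) x < j

/-- A finite set containing `u` in which every other element has a neighbour
strictly later in time is visited by a walk of length at most twice its size. -/
theorem exists_walk_covering (C : Finset (ℕ × V)) (u : ℕ × V) (hu : u ∈ C)
    (hC : ∀ a ∈ C, a ≠ u → ∃ b ∈ C, (spaceTime G).Adj b a ∧ b.1 = a.1 + 1) :
    ∃ (v : ℕ × V) (w : (spaceTime G).Walk u v), (∀ a ∈ C, a ∈ w.support) ∧
      w.length + 2 = 2 * C.card := by
  classical
  have key : ∀ m : ℕ, 1 ≤ m → m ≤ C.card → ∃ (T : Finset (ℕ × V)) (v : ℕ × V)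
      (w : (spaceTime G).Walk u v), T ⊆ C ∧ u ∈ T ∧ T.card = m ∧ (∀ a ∈ T, a ∈ w.support) ∧
      w.length + 2 = 2 * m := by
    intro m hm
    induction m, hm using Nat.le_induction with
    | base => exact fun _ => ⟨{u}, u, .nil, by simpa using hu, by simp, by simp, by simp, by simp⟩
    | succ m hm ih =>
      intro hmC
      obtain ⟨T, v, w, hTC, huT, hcard, hTw, hlen⟩ := ih (by omega)
      have hne : (C \ T).Nonempty := by
        rw [Finset.sdiff_nonempty]
        intro hCT
        have := Finset.card_le_card hCT
        omega
      -- Take a latest point not yet covered: its strictly later neighbour in `C` must already be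
      -- covered, and a detour of length two from that neighbour reaches the new point.
      obtain ⟨a, haCT, hmax⟩ := Finset.exists_max_image (C \ T) Prod.fst hne
      obtain ⟨haC, haT⟩ := Finset.mem_sdiff.1 haCT
      obtain ⟨b, hbC, hadj, hb⟩ := hC a haC (fun h => haT (h ▸ huT))
      have hbT : b ∈ T := by
        by_contra hbT
        have := hmax b (Finset.mem_sdiff.2 ⟨hbC, hbT⟩)
        omega
      have hbw := hTw b hbT
      refine ⟨insert a T, v, (w.takeUntil b hbw).append
        (.cons hadj (.cons hadj.symm (w.dropUntil b hbw))), ?_, ?_, ?_, ?_, ?_⟩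
      · exact Finset.insert_subset haC hTC
      · exact Finset.mem_insert_of_mem huT
      · rw [Finset.card_insert_of_notMem haT, hcard]
      · intro c hc
        rw [SimpleGraph.Walk.mem_support_append_iff]
        rcases Finset.mem_insert.1 hc with rfl | hc
        · right; simp
        · have h1 := hTw c hc
          rw [← w.take_spec hbw, SimpleGraph.Walk.mem_support_append_iff] at h1
          rcases h1 with h1 | h1
          · exact Or.inl h1
          · right
            simp [h1]
      · have h1 := congrArg SimpleGraph.Walk.length (w.take_spec hbw)
        rw [SimpleGraph.Walk.length_append] at h1
        simp only [SimpleGraph.Walk.length_append, SimpleGraph.Walk.length_cons]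
        omega
  obtain ⟨T, v, w, hTC, -, hcard, hTw, hlen⟩ := key C.card (Finset.card_pos.2 ⟨u, hu⟩) le_rfl
  obtain rfl := Finset.eq_of_subset_of_card_le hTC hcard.ge
  exact ⟨v, w, hTw, hlen⟩

end SpaceTime

/-! ## Clusters of zeros -/

section Cluster

variable {V : Type*} (G : SimpleGraph V) [G.LocallyFinite]

open Classical in
/-- The vertices reached from `x` in `m` steps backwards from time `t`, passing from a zero
outside `B` to its neighbours in state `0` one time step earlier. -/
def zeroCluster (η : ℕ → Config V) (B : Set (ℕ × V)) (t : ℕ) (x : V) : ℕ → Finset V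
  | 0 => {x}
  | m + 1 => (((zeroCluster η B t x m).filter fun y => (t - m, y) ∉ B).biUnion
      fun y => G.neighborFinset y).filter fun y => η (t - (m + 1)) y = false

variable {G} {η : ℕ → Config V} {B : Set (ℕ × V)} {j t : ℕ} {x : V}

theorem eq_false_of_mem_zeroCluster (hx : η t x = false) {m : ℕ} {y : V}
    (hy : y ∈ zeroCluster G η B t x m) : η (t - m) y = false := by
  cases m with
  | zero =>
    rw [zeroCluster, Finset.mem_singleton] at hy
    simpa [hy] using hx
  | succ m =>
    rw [zeroCluster, Finset.mem_filter] at hy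
    exact hy.2

theorem zeroCluster_eq_empty (h : ZeroRule G j t η B) (hx : η t x = false) :
    zeroCluster G η B t x t = ∅ := by
  refine Finset.eq_empty_of_forall_notMem fun y hy => ?_
  have h1 := eq_false_of_mem_zeroCluster hx hy
  rw [Nat.sub_self, h.1 y] at h1
  exact Bool.noConfusion h1

-- Every zero around a non-noisy point of one level belongs to the next level, and all but fewer
-- than `j` of its neighbours are zeros. This is the only way in which the update rule enters the
-- growth estimates.
open Classical in
theorem degree_lt_add_card_zeroCluster (h : ZeroRule G j t η B) (hx : η t x = false) {m : ℕ}
    (hm : m < t) {y : V} (hy : y ∈ zeroCluster G η B t x m) (hyB : (t - m, y) ∉ B) :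
    G.degree y < j + ((G.neighborFinset y).filter (· ∈ zeroCluster G η B t x (m + 1))).card := by
  have hs : t - m = t - (m + 1) + 1 := by omega
  have hy0 := eq_false_of_mem_zeroCluster hx hy
  have h1 : onesAround G (η (t - (m + 1))) y < j := by
    have := h.2 (t - (m + 1)) (by omega) y (by rw [← hs]; exact hy0)
    rw [← hs] at this
    exact this.resolve_left hyB
  have h2 : (G.neighborFinset y).card ≤ onesAround G (η (t - (m + 1))) y +
      ((G.neighborFinset y).filter (· ∈ zeroCluster G η B t x (m + 1))).card := by
    rw [onesAround, ← Finset.card_filter_add_card_filter_not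
      (s := G.neighborFinset y) (fun z => η (t - (m + 1)) z = true)]
    refine Nat.add_le_add_left (Finset.card_le_card fun z hz => ?_) _
    rw [Finset.mem_filter] at hz ⊢
    refine ⟨hz.1, ?_⟩
    rw [zeroCluster, Finset.mem_filter, Finset.mem_biUnion]
    exact ⟨⟨y, Finset.mem_filter.2 ⟨hy, hyB⟩, hz.1⟩, by simpa using hz.2⟩
  rw [SimpleGraph.card_neighborFinset_eq_degree] at h2
  omega

open Classical in
/-- If a potential along the levels of the cluster of `(t, x)` controls their size by the number
of their points in `B`, then a noisy walk starts at `(t, x)`. -/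
theorem hasNoisyWalk_of_potential (h : ZeroRule G j t η B) (hx : η t x = false)
    {c C : ℝ} (hc : 0 < c) (E : ℕ → ℝ) (hE0 : 0 ≤ E 0) (hEt : E t ≤ 0)
    (hE : ∀ m < t, c * (zeroCluster G η B t x m).card ≤ E (m + 1) - E m +
      C * ((zeroCluster G η B t x m).filter fun y => (t - m, y) ∈ B).card) :
    HasNoisyWalk (spaceTime G) ⌈2 * C / c⌉₊ B (t, x) := by
  have ht : 0 < t := by
    rcases Nat.eq_zero_or_pos t with rfl | ht
    · have := h.1 x
      rw [hx] at this
      exact Bool.noConfusion this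
    · exact ht
  set K := zeroCluster G η B t x with hK
  have inj : ∀ F : ℕ → Finset V, Set.InjOn (fun p : (_ : ℕ) × V => (t - p.1, p.2))
      ((Finset.range t).sigma F : Finset ((_ : ℕ) × V)) := by
    rintro F ⟨m, y⟩ hp ⟨m', y'⟩ hq hpq
    simp only [Finset.coe_sigma, Set.mem_sigma_iff, Finset.mem_coe, Finset.mem_range] at hp hq
    simp only [Prod.mk.injEq] at hpq
    obtain ⟨h1, rfl⟩ := hpq
    obtain rfl : m = m' := by omega
    rfl
  set Z := ((Finset.range t).sigma K).image (fun p : (_ : ℕ) × V => (t - p.1, p.2)) with hZ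
  set S := ((Finset.range t).sigma fun m => (K m).filter fun y => (t - m, y) ∈ B).image
    (fun p : (_ : ℕ) × V => (t - p.1, p.2)) with hS
  have hZcard : Z.card = ∑ m ∈ Finset.range t, (K m).card := by
    rw [hZ, Finset.card_image_of_injOn (inj _), Finset.card_sigma]
  have hScard : S.card = ∑ m ∈ Finset.range t, ((K m).filter fun y => (t - m, y) ∈ B).card := by
    rw [hS, Finset.card_image_of_injOn (inj _), Finset.card_sigma]
  have memZ : ∀ m < t, ∀ y ∈ K m, (t - m, y) ∈ Z := fun m hm y hy =>
    Finset.mem_image.2 ⟨⟨m, y⟩, Finset.mem_sigma.2 ⟨Finset.mem_range.2 hm, hy⟩, rfl⟩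
  obtain ⟨v, w, hw, hlen⟩ := exists_walk_covering G Z (t, x)
    (by simpa using memZ 0 ht x (by simp [hK, zeroCluster])) (by
      intro a ha hne
      obtain ⟨⟨m, y⟩, hp, rfl⟩ := Finset.mem_image.1 ha
      rw [Finset.mem_sigma, Finset.mem_range] at hp
      obtain ⟨hm, hy⟩ := hp
      cases m with
      | zero =>
        simp only [hK, zeroCluster, Finset.mem_singleton] at hy
        simp [hy] at hne
      | succ m =>
        simp only [hK, zeroCluster, Finset.mem_filter, Finset.mem_biUnion] at hy hm
        obtain ⟨⟨z, ⟨hz, -⟩, hzy⟩, -⟩ := hy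
        have h1 : t - m = t - (m + 1) + 1 := by omega
        exact ⟨(t - m, z), memZ m (by omega) z hz,
          ⟨by simpa using hzy, Or.inl h1⟩, h1⟩)
  refine ⟨v, w, S, ?_, ?_, ?_⟩
  · intro a ha
    obtain ⟨⟨m, y⟩, hp, rfl⟩ := Finset.mem_image.1 ha
    exact (Finset.mem_filter.1 (Finset.mem_sigma.1 hp).2).2
  · intro a ha
    obtain ⟨⟨m, y⟩, hp, rfl⟩ := Finset.mem_image.1 ha
    rw [Finset.mem_sigma, Finset.mem_range, Finset.mem_filter] at hp
    exact hw _ (memZ m hp.1 y hp.2.1)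
  · have hsum : c * Z.card ≤ C * S.card := by
      rw [hZcard, hScard]
      push_cast
      rw [Finset.mul_sum, Finset.mul_sum]
      -- The potential differences telescope to `E t - E 0 ≤ 0`, leaving only the noisy points to
      -- pay for the size of the cluster.
      have h1 := Finset.sum_le_sum fun m (hm : m ∈ Finset.range t) => hE m (Finset.mem_range.1 hm)
      rw [Finset.sum_add_distrib, Finset.sum_range_sub] at h1
      linarith
    have h2 : (2 : ℝ) * Z.card ≤ ⌈2 * C / c⌉₊ * S.card := by
      calc (2 : ℝ) * Z.card ≤ 2 * C / c * S.card := by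
            rw [div_mul_eq_mul_div, le_div_iff₀ hc]
            linarith
        _ ≤ _ := mul_le_mul_of_nonneg_right (Nat.le_ceil _) (Nat.cast_nonneg _)
    have h3 : 2 * Z.card ≤ ⌈2 * C / c⌉₊ * S.card := by exact_mod_cast h2
    omega

end Cluster

/-! ## Vertex expansion -/

section VertexExpansion

variable {V : Type*} {G : SimpleGraph V}

theorem vertexExpansion_mul_card_le (A : Finset V) :
    vertexExpansion G * A.card ≤ (vertexBdry G A).ncard := by
  rcases A.eq_empty_or_nonempty with rfl | hA
  · simp
  · rw [← le_div_iff₀ (by exact_mod_cast hA.card_pos)]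
    exact ciInf_le (f := fun K : {K : Finset V // K.Nonempty} =>
      ((vertexBdry G K.1).ncard : ℝ) / (K.1.card : ℝ))
      ⟨0, by rintro _ ⟨K, rfl⟩; positivity⟩ ⟨A, hA⟩

variable [G.LocallyFinite]

-- Let `A` be the non-noisy part of a level. Each point of `A` has at most `j - 1` neighbours
-- outside the next level, so the next level has at least `(Φ_V - (j - 1)) * |A|` points, a growth
-- factor above `1`. The potential is the size of the level.
open Classical in
theorem hasNoisyWalk_of_lt_vertexExpansion {j : ℕ} (hj : 1 ≤ j)
    (hV : (j : ℝ) < vertexExpansion G) : ∃ k : ℕ, ∀ (t : ℕ) (η : ℕ → Config V) (B : Set (ℕ × V)),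
      ZeroRule G j t η B → ∀ x, η t x = false → HasNoisyWalk (spaceTime G) k B (t, x) := by
  refine ⟨⌈2 * (vertexExpansion G - j + 1) / (vertexExpansion G - j)⌉₊,
    fun t η B h x hx => ?_⟩
  refine hasNoisyWalk_of_potential h hx (by linarith)
    (fun m => ((zeroCluster G η B t x m).card : ℝ)) (by positivity) ?_ fun m hm => ?_
  · simp [zeroCluster_eq_empty h hx]
  · set K := zeroCluster G η B t x with hK
    set A := (K m).filter fun y => (t - m, y) ∉ B with hA
    have hcard : (((K m).filter fun y => (t - m, y) ∈ B).card : ℝ) + A.card = (K m).card := by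
      exact_mod_cast Finset.card_filter_add_card_filter_not (s := K m) fun y => (t - m, y) ∈ B
    have hsub : vertexBdry G A ⊆
        ↑(K (m + 1) ∪ A.biUnion fun a => (G.neighborFinset a).filter (· ∉ K (m + 1))) := by
      rintro y ⟨-, a, ha, hay⟩
      simp only [Finset.coe_union, Set.mem_union, Finset.mem_coe, Finset.mem_biUnion,
        Finset.mem_filter, SimpleGraph.mem_neighborFinset]
      by_cases hyK : y ∈ K (m + 1)
      · exact Or.inl hyK
      · exact Or.inr ⟨a, ha, hay.symm, hyK⟩
    have h1 : (vertexBdry G A).ncard ≤ (K (m + 1)).card + A.card * (j - 1) := by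
      refine (Set.ncard_le_ncard hsub (Finset.finite_toSet _)).trans ?_
      rw [Set.ncard_coe_finset]
      refine (Finset.card_union_le _ _).trans (Nat.add_le_add_left ?_ _)
      refine Finset.card_biUnion_le_card_mul _ _ _ fun a ha => ?_
      obtain ⟨haK, haB⟩ := Finset.mem_filter.1 ha
      have h2 := degree_lt_add_card_zeroCluster h hx hm haK haB
      have h3 := Finset.card_filter_add_card_filter_not (s := G.neighborFinset a)
        (· ∈ K (m + 1))
      rw [SimpleGraph.card_neighborFinset_eq_degree] at h3
      rw [← hK] at h2
      omega
    have h4 : ((vertexBdry G A).ncard : ℝ) ≤ (K (m + 1)).card + A.card * (j - 1) := by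
      have : ((j - 1 : ℕ) : ℝ) = j - 1 := by push_cast [hj]; ring
      rw [← this]
      exact_mod_cast h1
    have h5 := vertexExpansion_mul_card_le (G := G) A
    rw [← hcard] at *
    nlinarith

end VertexExpansion

/-! ## Edge expansion -/

section EdgeExpansion

variable {V : Type*} {G : SimpleGraph V}

theorem edgeExpansion_mul_card_le (A : Finset V) :
    edgeExpansion G * A.card ≤ (edgeBdry G A).ncard := by
  rcases A.eq_empty_or_nonempty with rfl | hA
  · simp
  · rw [← le_div_iff₀ (by exact_mod_cast hA.card_pos)]
    exact ciInf_le (f := fun K : {K : Finset V // K.Nonempty} =>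
      ((edgeBdry G K.1).ncard : ℝ) / (K.1.card : ℝ))
      ⟨0, by rintro _ ⟨K, rfl⟩; positivity⟩ ⟨A, hA⟩

variable [G.LocallyFinite]

variable (G) in
open Classical in
/-- The number of pairs `(a, b) ∈ A × B` of neighbours. -/
def edgePairs (A B : Finset V) : ℕ :=
  ∑ a ∈ A, ((G.neighborFinset a).filter (· ∈ B)).card

open Classical in
theorem edgePairs_eq_sum {A B U : Finset V} (hA : A ⊆ U) (hB : B ⊆ U) :
    edgePairs G A B = ∑ p ∈ (U ×ˢ U).filter (fun p => G.Adj p.1 p.2),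
      (if p.1 ∈ A ∧ p.2 ∈ B then 1 else 0) := by
  rw [← Finset.card_filter, Finset.filter_filter, edgePairs, ← Finset.card_sigma]
  refine Finset.card_bij (fun p _ => (p.1, p.2)) ?_ ?_ ?_
  · rintro ⟨a, b⟩ h
    simp only [Finset.mem_sigma, Finset.mem_filter, SimpleGraph.mem_neighborFinset] at h
    simp only [Finset.mem_filter, Finset.mem_product]
    exact ⟨⟨hA h.1, hB h.2.2⟩, h.2.1, h.1, h.2.2⟩
  · rintro ⟨a, b⟩ _ ⟨a', b'⟩ _ h
    simp only [Prod.mk.injEq] at h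
    obtain ⟨rfl, rfl⟩ := h
    rfl
  · rintro ⟨a, b⟩ h
    simp only [Finset.mem_filter, Finset.mem_product] at h
    exact ⟨⟨a, b⟩, by simp [h.2.1, h.2.2.1, h.2.2.2], rfl⟩

theorem edgePairs_comm (A B : Finset V) : edgePairs G A B = edgePairs G B A := by
  classical
  rw [edgePairs_eq_sum (Finset.subset_union_left (s₁ := A) (s₂ := B)) Finset.subset_union_right,
    edgePairs_eq_sum (Finset.subset_union_right (s₁ := A) (s₂ := B)) Finset.subset_union_left]
  refine Finset.sum_bij' (fun p _ => p.swap) (fun p _ => p.swap) ?_ ?_ ?_ ?_ ?_ <;>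
    simp +contextual [G.adj_comm, and_comm]
  all_goals
    intros
    tauto

-- Write `2 * edgePairs G A B` symmetrically as `e(A, B) + e(B, A)`; the inequality then holds for
-- the indicators of each ordered pair of neighbours.
open Classical in
theorem two_mul_edgePairs_le (A B : Finset V) :
    2 * edgePairs G A B ≤ edgePairs G (A ∪ B) (A ∪ B) + edgePairs G (A ∩ B) (A ∩ B) := by
  have hl : A ⊆ A ∪ B := Finset.subset_union_left
  have hr : B ⊆ A ∪ B := Finset.subset_union_right
  have hi : A ∩ B ⊆ A ∪ B := Finset.inter_subset_left.trans hl
  rw [two_mul]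
  nth_rw 2 [edgePairs_comm]
  rw [edgePairs_eq_sum hl hr, edgePairs_eq_sum hr hl, edgePairs_eq_sum hi hi,
    edgePairs_eq_sum subset_rfl subset_rfl, ← Finset.sum_add_distrib, ← Finset.sum_add_distrib]
  refine Finset.sum_le_sum fun p _ => ?_
  by_cases h1 : p.1 ∈ A <;> by_cases h2 : p.1 ∈ B <;> by_cases h3 : p.2 ∈ A <;>
    by_cases h4 : p.2 ∈ B <;> simp [h1, h2, h3, h4]

theorem ncard_edgeBdry_add_edgePairs_le (A : Finset V) :
    (edgeBdry G A).ncard + edgePairs G A A ≤ ∑ a ∈ A, G.degree a := by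
  classical
  have hsub : edgeBdry G A ⊆ ↑((A.sigma fun a => (G.neighborFinset a).filter (· ∉ A)).image
      fun p : (_ : V) × V => s(p.1, p.2)) := by
    rintro e ⟨he, a, ha, b, hb, rfl⟩
    rw [SimpleGraph.mem_edgeSet] at he
    rw [Finset.mem_coe, Finset.mem_image]
    exact ⟨⟨a, b⟩, by simp [ha, hb, he], rfl⟩
  have h1 : (edgeBdry G A).ncard ≤ ∑ a ∈ A, ((G.neighborFinset a).filter (· ∉ A)).card := by
    refine (Set.ncard_le_ncard hsub (Finset.finite_toSet _)).trans ?_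
    rw [Set.ncard_coe_finset]
    exact Finset.card_image_le.trans (Finset.card_sigma _ _).le
  calc (edgeBdry G A).ncard + edgePairs G A A
      ≤ ∑ a ∈ A, (((G.neighborFinset a).filter (· ∉ A)).card +
          ((G.neighborFinset a).filter (· ∈ A)).card) := by
        rw [Finset.sum_add_distrib]
        exact Nat.add_le_add_right h1 _
    _ = ∑ a ∈ A, G.degree a := by
        refine Finset.sum_congr rfl fun a _ => ?_
        rw [add_comm, Finset.card_filter_add_card_filter_not,
          SimpleGraph.card_neighborFinset_eq_degree]

/-- Edge expansion of `G` controls the edge expansion of its bipartite double cover. -/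
theorem edgeExpansion_mul_add_le (A B : Finset V) :
    edgeExpansion G * (A.card + B.card) + 2 * edgePairs G A B ≤
      (∑ a ∈ A, G.degree a : ℕ) + (∑ b ∈ B, G.degree b : ℕ) := by
  classical
  -- Expansion is applied to the union and the intersection: together they have the same cardinality
  -- and the same total degree as `A` and `B`, and by `two_mul_edgePairs_le` at least as many
  -- internal pairs as `2 * edgePairs G A B`.
  have h1 := edgeExpansion_mul_card_le (G := G) (A ∪ B)
  have h2 := edgeExpansion_mul_card_le (G := G) (A ∩ B)
  have h3 := ncard_edgeBdry_add_edgePairs_le (G := G) (A ∪ B)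
  have h4 := ncard_edgeBdry_add_edgePairs_le (G := G) (A ∩ B)
  have h5 := two_mul_edgePairs_le (G := G) A B
  have h6 : (∑ a ∈ A ∪ B, G.degree a) + ∑ a ∈ A ∩ B, G.degree a =
      (∑ a ∈ A, G.degree a) + ∑ b ∈ B, G.degree b := Finset.sum_union_inter
  have h7 : ((A ∪ B).card : ℝ) + (A ∩ B).card = A.card + B.card := by
    exact_mod_cast Finset.card_union_add_card_inter A B
  have h8 : ((edgeBdry G (A ∪ B)).ncard : ℝ) + (edgeBdry G (A ∩ B)).ncard + 2 * edgePairs G A B ≤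
      (∑ a ∈ A, G.degree a : ℕ) + (∑ b ∈ B, G.degree b : ℕ) := by
    exact_mod_cast (by omega : (edgeBdry G (A ∪ B)).ncard + (edgeBdry G (A ∩ B)).ncard +
      2 * edgePairs G A B ≤ (∑ a ∈ A, G.degree a) + (∑ b ∈ B, G.degree b))
  rw [← h7]
  linarith

theorem edgeExpansion_le_degree (x : V) : edgeExpansion G ≤ G.degree x := by
  have h1 := edgeExpansion_mul_card_le (G := G) {x}
  have h2 := ncard_edgeBdry_add_edgePairs_le (G := G) {x}
  rw [Finset.sum_singleton] at h2
  have h3 : ((edgeBdry G {x}).ncard : ℝ) ≤ G.degree x := by exact_mod_cast (by omega)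
  simp only [Finset.card_singleton, Nat.cast_one, mul_one] at h1
  linarith

-- The potential is the number of edges from the non-noisy part `A i` of a level to the next level
-- `K (i + 1)`. A non-noisy point sends at least `deg - j + 1` edges to the next level, while
-- expansion of the pair `A i`, `K (i + 1)` bounds the edges between them by their degrees.
-- Combining the two, the edge count increases by at least `c * |K (i + 1)|` up to a multiple of the
-- number of noisy points.
open Classical in
theorem hasNoisyWalk_of_lt_edgeExpansion {j D : ℕ} (hD : ∀ x, G.degree x ≤ D)
    (hδ : ∀ x, j ≤ G.degree x) (hE : (j : ℝ) < edgeExpansion G + 1) :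
    ∃ k : ℕ, ∀ (t : ℕ) (η : ℕ → Config V) (B : Set (ℕ × V)),
      ZeroRule G j t η B → ∀ x, η t x = false → HasNoisyWalk (spaceTime G) k B (t, x) := by
  set c : ℝ := min (edgeExpansion G + 1 - j) 1 with hc
  have hc0 : 0 < c := lt_min (by linarith) one_pos
  have hc1 : c ≤ 1 := min_le_right _ _
  have hcE : c ≤ edgeExpansion G + 1 - j := min_le_left _ _
  refine ⟨⌈2 * ((D : ℝ) + 1) / c⌉₊, fun t η B h x hx => ?_⟩
  set K := zeroCluster G η B t x with hK
  set A : ℕ → Finset V := fun m => (K m).filter fun y => (t - m, y) ∉ B with hA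
  set N : ℕ → Finset V := fun m => (K m).filter fun y => (t - m, y) ∈ B with hN
  have hvol : ∀ m < t, (∑ a ∈ A m, G.degree a) + (A m).card ≤
      (A m).card * j + edgePairs G (A m) (K (m + 1)) := by
    intro m hm
    calc (∑ a ∈ A m, G.degree a) + (A m).card = ∑ a ∈ A m, (G.degree a + 1) := by
          rw [Finset.sum_add_distrib]; simp
      _ ≤ ∑ a ∈ A m, (j + ((G.neighborFinset a).filter (· ∈ K (m + 1))).card) := by
          refine Finset.sum_le_sum fun a ha => ?_
          obtain ⟨haK, haB⟩ := Finset.mem_filter.1 ha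
          exact degree_lt_add_card_zeroCluster h hx hm haK haB
      _ = _ := by rw [Finset.sum_add_distrib]; simp [edgePairs]
  have hcard : ∀ m, ((N m).card : ℝ) + (A m).card = (K m).card := fun m => by
    exact_mod_cast Finset.card_filter_add_card_filter_not (s := K m) fun y => (t - m, y) ∈ B
  have hdeg : ∀ m, (∑ a ∈ K m, G.degree a) ≤ (N m).card * D + ∑ a ∈ A m, G.degree a := by
    intro m
    rw [← Finset.sum_filter_add_sum_filter_not (K m) fun y => (t - m, y) ∈ B]
    exact Nat.add_le_add_right (Finset.sum_le_card_nsmul _ _ _ fun a _ => hD a) _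
  have hK0 : K 0 = {x} := by rw [hK, zeroCluster]
  have hKt : K t = ∅ := zeroCluster_eq_empty h hx
  refine hasNoisyWalk_of_potential h hx hc0
    -- Level `0` has no preceding level, so its potential is set to `0`. The first increment is then
    -- handled separately, using `j ≤ deg` and `c ≤ 1`.
    (fun m => Nat.casesOn m 0 fun i => (edgePairs G (A i) (K (i + 1)) : ℝ)) le_rfl ?_ ?_
  · cases t with
    | zero => exact le_rfl
    | succ i =>
      show ((edgePairs G (A i) (K (i + 1)) : ℕ) : ℝ) ≤ 0
      rw [hKt]
      simp [edgePairs]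
  · intro m hm
    have hv : ((∑ a ∈ A m, G.degree a : ℕ) : ℝ) + (A m).card ≤
        (A m).card * j + edgePairs G (A m) (K (m + 1)) := by exact_mod_cast hvol m hm
    have hd : ((∑ a ∈ K m, G.degree a : ℕ) : ℝ) ≤
        (N m).card * D + (∑ a ∈ A m, G.degree a : ℕ) := by exact_mod_cast hdeg m
    have hk := hcard m
    cases m with
    | zero =>
      show c * (K 0).card ≤ (edgePairs G (A 0) (K (0 + 1)) : ℝ) - 0 + (D + 1) * (N 0).card
      have hj : ((A 0).card : ℝ) * j ≤ (∑ a ∈ A 0, G.degree a : ℕ) := by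
        exact_mod_cast Finset.card_nsmul_le_sum (A 0) _ j fun a _ => hδ a
      have hD0 : 0 ≤ (D : ℝ) * (N 0).card := by positivity
      rw [← hk]
      nlinarith [Nat.cast_nonneg (α := ℝ) (N 0).card, Nat.cast_nonneg (α := ℝ) (A 0).card]
    | succ i =>
      show c * (K (i + 1)).card ≤ (edgePairs G (A (i + 1)) (K (i + 1 + 1)) : ℝ) -
        edgePairs G (A i) (K (i + 1)) + (D + 1) * (N (i + 1)).card
      have hv' : ((∑ a ∈ A i, G.degree a : ℕ) : ℝ) + (A i).card ≤
        (A i).card * j + edgePairs G (A i) (K (i + 1)) := by exact_mod_cast hvol i (by omega)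
      have he := edgeExpansion_mul_add_le (G := G) (A i) (K (i + 1))
      have hj0 : (0 : ℝ) ≤ j := Nat.cast_nonneg j
      have h1 : c * (K (i + 1)).card ≤ (edgeExpansion G + 1 - j) * (K (i + 1)).card :=
        mul_le_mul_of_nonneg_right hcE (Nat.cast_nonneg _)
      have h2 : 0 ≤ (edgeExpansion G + 1 - j) * (A i).card :=
        mul_nonneg (by linarith) (Nat.cast_nonneg _)
      have h3 : 0 ≤ (j : ℝ) * (N (i + 1)).card := by positivity
      have h4 : (j : ℝ) * (K (i + 1)).card = j * (N (i + 1)).card + j * (A (i + 1)).card := by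
        rw [← hk]; ring
      linarith

end EdgeExpansion

/-! ## Trees -/

section Tree

variable {V : Type*} {G : SimpleGraph V}

/-- If both neighbours were closer to `q`, geodesics through them would be two different paths from
`p` to `q`. Consequently, among any two neighbours one can step away from `q`. -/
theorem dist_eq_add_one_or_of_ne (hG : G.IsTree) {p y z : V} (hy : G.Adj p y) (hz : G.Adj p z)
    (hne : y ≠ z) (q : V) :
    G.dist y q = G.dist p q + 1 ∨ G.dist z q = G.dist p q + 1 := by
  rcases hG.dist_eq_dist_add_one_of_adj q hy with h1 | h1
  · rcases hG.dist_eq_dist_add_one_of_adj q hz with h2 | h2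
    · exfalso
      obtain ⟨r, hr⟩ := hG.connected.exists_walk_length_eq_dist y q
      obtain ⟨r', hr'⟩ := hG.connected.exists_walk_length_eq_dist z q
      rw [G.dist_comm (u := q), G.dist_comm (u := q)] at h1 h2
      have e1 := SimpleGraph.Walk.isPath_of_length_eq_dist (.cons hy r)
        (by rw [SimpleGraph.Walk.length_cons]; omega)
      have e2 := SimpleGraph.Walk.isPath_of_length_eq_dist (.cons hz r')
        (by rw [SimpleGraph.Walk.length_cons]; omega)
      have e3 := (hG.existsUnique_path p q).unique e1 e2
      simp only [SimpleGraph.Walk.cons.injEq] at e3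
      exact hne e3.1
    · exact Or.inr (by rw [G.dist_comm, h2, G.dist_comm])
  · exact Or.inl (by rw [G.dist_comm, h1, G.dist_comm])

variable (G) in
/-- `a` is a zero outside `B`, not later than time `s`, and `b` is a zero at a neighbouring vertex
one time step before `a`. -/
def ZeroLink (η : ℕ → Config V) (B : Set (ℕ × V)) (s : ℕ) (a b : ℕ × V) : Prop :=
  a.1 = b.1 + 1 ∧ a.1 ≤ s ∧ G.Adj a.2 b.2 ∧ η a.1 a.2 = false ∧ η b.1 b.2 = false ∧ a ∉ B

variable (G) in
/-- The graph of the links between zeros up to time `s`. -/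
def zeroGraph (η : ℕ → Config V) (B : Set (ℕ × V)) (s : ℕ) : SimpleGraph (ℕ × V) where
  Adj a b := ZeroLink G η B s a b ∨ ZeroLink G η B s b a
  symm := ⟨fun _ _ h => h.symm⟩
  loopless := ⟨fun a h => by
    have h1 : ZeroLink G η B s a a := or_self_iff.1 h
    have := h1.1
    omega⟩

variable (G) in
/-- Components of the graph of links up to time `s` are adjacent if they contain neighbours, at
time `s`, of a common point at time `s + 1`. -/
def forkGraph (η : ℕ → Config V) (B : Set (ℕ × V)) (s : ℕ) :
    SimpleGraph (zeroGraph G η B s).ConnectedComponent where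
  Adj c d := c ≠ d ∧ ∃ x e f, ZeroLink G η B (s + 1) (s + 1, x) (s, e) ∧
    ZeroLink G η B (s + 1) (s + 1, x) (s, f) ∧
    (zeroGraph G η B s).connectedComponentMk (s, e) = c ∧
    (zeroGraph G η B s).connectedComponentMk (s, f) = d
  symm := ⟨fun _ _ ⟨hne, x, e, f, h1, h2, h3, h4⟩ => ⟨hne.symm, x, f, e, h2, h1, h4, h3⟩⟩
  loopless := ⟨fun _ h => h.1 rfl⟩

variable {η : ℕ → Config V} {B : Set (ℕ × V)}

theorem zeroGraph_le_succ (s : ℕ) : zeroGraph G η B s ≤ zeroGraph G η B (s + 1) := by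
  intro a b h
  rcases h with ⟨h1, h2, h3⟩ | ⟨h1, h2, h3⟩
  · exact Or.inl ⟨h1, by omega, h3⟩
  · exact Or.inr ⟨h1, by omega, h3⟩

/-- A noisy point at the latest time `s` is isolated: it has no link backwards because it lies in
`B`, and links forwards would exceed time `s`. -/
theorem eq_of_reachable_of_mem {s : ℕ} {p : V} (hp : (s, p) ∈ B) {b : ℕ × V}
    (h : (zeroGraph G η B s).Reachable (s, p) b) : b = (s, p) := by
  obtain ⟨w⟩ := h
  cases w with
  | nil => rfl
  | cons h _ =>
    rcases h with ⟨-, -, -, -, -, h⟩ | ⟨h1, h2, -⟩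
    · exact absurd hp h
    · simp only at h1
      omega

/-- A walk between time-`s` points that may use time `s + 1` visits that time only at isolated
steps, each entering and leaving through two neighbours of one point. Such a step is a fork; between
forks the walk stays in one component. -/
theorem forkGraph_reachable_of_reachable {s : ℕ} {p q : V}
    (h : (zeroGraph G η B (s + 1)).Reachable (s, p) (s, q)) :
    (forkGraph G η B s).Reachable ((zeroGraph G η B s).connectedComponentMk (s, p))
      ((zeroGraph G η B s).connectedComponentMk (s, q)) := by
  set mk := (zeroGraph G η B s).connectedComponentMk with hmk
  have fork : ∀ x e f, ZeroLink G η B (s + 1) (s + 1, x) (s, e) →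
      ZeroLink G η B (s + 1) (s + 1, x) (s, f) →
      (forkGraph G η B s).Reachable (mk (s, e)) (mk (s, f)) := by
    intro x e f h1 h2
    by_cases hef : mk (s, e) = mk (s, f)
    · rw [hef]
    · exact SimpleGraph.Adj.reachable ⟨hef, x, e, f, h1, h2, rfl, rfl⟩
  -- At time `s + 1` the current point has no component up to time `s`, so the invariant there
  -- concerns every point linked below it.
  have key : ∀ a, Relation.ReflTransGen (zeroGraph G η B (s + 1)).Adj (s, p) a →
      (a.1 ≤ s → (forkGraph G η B s).Reachable (mk (s, p)) (mk a)) ∧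
      (a.1 = s + 1 → ∀ b, ZeroLink G η B (s + 1) a b →
        (forkGraph G η B s).Reachable (mk (s, p)) (mk b)) := by
    intro a ha
    induction ha with
    | refl => exact ⟨fun _ => SimpleGraph.Reachable.refl _, fun h => absurd h (by simp)⟩
    | @tail a b _ hab ih =>
      obtain ⟨ih1, ih2⟩ := ih
      rcases hab with hab | hab
      · rcases Nat.lt_or_ge s a.1 with has | has
        · have h1 : a.1 = s + 1 := le_antisymm hab.2.1 has
          refine ⟨fun _ => ih2 h1 b hab, fun hb => ?_⟩
          have := hab.1
          omega
        · have h1 := hab.1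
          have h2 : (zeroGraph G η B s).Adj a b := Or.inl ⟨hab.1, has, hab.2.2⟩
          have h3 : mk a = mk b := SimpleGraph.ConnectedComponent.sound h2.reachable
          exact ⟨fun _ => h3 ▸ ih1 has, fun hb => by omega⟩
      · have h1 := hab.1
        have h4 := hab.2.1
        refine ⟨fun hb => ?_, fun hb c hbc => ?_⟩
        · have h2 : (zeroGraph G η B s).Adj a b := Or.inr ⟨hab.1, hb, hab.2.2⟩
          have h3 : mk a = mk b := SimpleGraph.ConnectedComponent.sound h2.reachable
          exact h3 ▸ ih1 (by omega)
        · obtain ⟨b1, x⟩ := b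
          obtain ⟨a1, e⟩ := a
          obtain ⟨c1, f⟩ := c
          have h5 := hbc.1
          simp only at hb h1 h5
          obtain rfl : a1 = s := by omega
          obtain rfl : c1 = a1 := by omega
          subst hb
          exact (ih1 le_rfl).trans (fork x e f hab hbc)
  exact (key _ ((SimpleGraph.reachable_iff_reflTransGen _ _).1 h)).1 le_rfl

variable (G) in
/-- A space-time walk between vertices `p` and `q` at time `s`, and a set of vertices of `B` visited
by the walk and satisfying `R`, that is large with respect to the walk and the distance from `p`
to `q`. -/
def HasNoisyPassage (B : Set (ℕ × V)) (s : ℕ) (p q : V) (R : ℕ × V → Prop) : Prop :=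
  ∃ (w : (spaceTime G).Walk (s, p) (s, q)) (S : Finset (ℕ × V)), (∀ a ∈ S, a ∈ B) ∧
    (∀ a ∈ S, a ∈ w.support) ∧ (∀ a ∈ S, R a) ∧ w.length + G.dist p q + 4 ≤ 4 * S.card

/-- Passages inside the successive components are joined across forks. The components on a path are
distinct, so the noisy sets are disjoint and their sizes add. Each fork adds at most `2` to the
length and `2` to the distance, which is exactly the additive `4` gained from the extra passage. -/
theorem hasNoisyPassage_of_forkGraph_path (hG : G.IsTree) {s : ℕ}
    (ih : ∀ p q, η s p = false → η s q = false →
      (zeroGraph G η B s).Reachable (s, p) (s, q) →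
      HasNoisyPassage G B s p q ((zeroGraph G η B s).Reachable (s, p)))
    {c d : (zeroGraph G η B s).ConnectedComponent} (π : (forkGraph G η B s).Walk c d)
    (hπ : π.IsPath) (p q : V) (hp : η s p = false) (hq : η s q = false)
    (hc : (zeroGraph G η B s).connectedComponentMk (s, p) = c)
    (hd : (zeroGraph G η B s).connectedComponentMk (s, q) = d) :
    HasNoisyPassage G B s p q fun a =>
      (zeroGraph G η B s).connectedComponentMk a ∈ π.support ∧
      (zeroGraph G η B (s + 1)).Reachable (s, p) a := by
  classical
  induction π generalizing p with
  | nil =>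
    have hr := SimpleGraph.ConnectedComponent.exact (hc.trans hd.symm)
    obtain ⟨w, S, h1, h2, h3, h4⟩ := ih p q hp hq hr
    refine ⟨w, S, h1, h2, fun a ha => ⟨?_, (h3 a ha).mono (zeroGraph_le_succ s)⟩, h4⟩
    rw [SimpleGraph.Walk.support_nil, List.mem_singleton, ← hc]
    exact SimpleGraph.ConnectedComponent.sound (h3 a ha).symm
  | @cons c c' d h π hind =>
    rw [SimpleGraph.Walk.cons_isPath_iff] at hπ
    have hfork := h
    obtain ⟨-, x, e, f, hxe, hxf, he, hf⟩ := hfork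
    have hpe := SimpleGraph.ConnectedComponent.exact (hc.trans he.symm)
    obtain ⟨w₁, S₁, hB₁, hw₁, hR₁, hl₁⟩ := ih p e hp hxe.2.2.2.2.1 hpe
    obtain ⟨w₂, S₂, hB₂, hw₂, hR₂, hl₂⟩ := hind hπ.1 f hxf.2.2.2.2.1 hf hd
    have hex : (spaceTime G).Adj (s, e) (s + 1, x) := ⟨hxe.2.2.1.symm, Or.inr rfl⟩
    have hxf' : (spaceTime G).Adj (s + 1, x) (s, f) := ⟨hxf.2.2.1, Or.inl rfl⟩
    have hmk₁ : ∀ a ∈ S₁, (zeroGraph G η B s).connectedComponentMk a = c := fun a ha =>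
      hc ▸ SimpleGraph.ConnectedComponent.sound (hR₁ a ha).symm
    have hdisj : Disjoint S₁ S₂ := by
      rw [Finset.disjoint_left]
      intro a ha₁ ha₂
      exact hπ.2 (hmk₁ a ha₁ ▸ (hR₂ a ha₂).1)
    have hpf : (zeroGraph G η B (s + 1)).Reachable (s, p) (s, f) :=
      (hpe.mono (zeroGraph_le_succ s)).trans
        ((SimpleGraph.Adj.reachable (Or.inr hxe)).trans (SimpleGraph.Adj.reachable (Or.inl hxf)))
    refine ⟨w₁.append (.cons hex (.cons hxf' w₂)), S₁ ∪ S₂, ?_, ?_, ?_, ?_⟩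
    · intro a ha
      exact (Finset.mem_union.1 ha).elim (hB₁ a) (hB₂ a)
    · intro a ha
      rw [SimpleGraph.Walk.mem_support_append_iff]
      rcases Finset.mem_union.1 ha with ha | ha
      · exact Or.inl (hw₁ a ha)
      · right
        simp [hw₂ a ha]
    · intro a ha
      rw [SimpleGraph.Walk.support_cons, List.mem_cons]
      rcases Finset.mem_union.1 ha with ha | ha
      · exact ⟨Or.inl (hmk₁ a ha), (hR₁ a ha).mono (zeroGraph_le_succ s)⟩
      · exact ⟨Or.inr (hR₂ a ha).1, hpf.trans (hR₂ a ha).2⟩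
    · rw [Finset.card_union_of_disjoint hdisj]
      simp only [SimpleGraph.Walk.length_append, SimpleGraph.Walk.length_cons]
      have d1 := hG.connected.dist_triangle (u := p) (v := e) (w := q)
      have d2 := hG.connected.dist_triangle (u := e) (v := f) (w := q)
      have d3 := hG.connected.dist_triangle (u := e) (v := x) (w := f)
      rw [SimpleGraph.dist_eq_one_iff_adj.2 hxe.2.2.1.symm,
        SimpleGraph.dist_eq_one_iff_adj.2 hxf.2.2.1] at d3
      omega

/-- Induction on time. If an endpoint is noisy it is isolated, so both coincide and one noisy point
suffices. Otherwise each endpoint has two zero neighbours one step earlier, and one of them is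
farther from the other endpoint. Moving both ends outwards raises the distance by `2`, which pays
for the two steps added to the walk. -/
theorem hasNoisyPassage_of_reachable (hG : G.IsTree) {t : ℕ} (h0 : ∀ x, η 0 x = true)
    (h2 : ∀ s < t, ∀ x, η (s + 1) x = false → (s + 1, x) ∉ B →
      ∃ y z, y ≠ z ∧ (G.Adj x y ∧ η s y = false) ∧ (G.Adj x z ∧ η s z = false))
    (s : ℕ) (hs : s ≤ t) (p q : V) (hp : η s p = false) (hq : η s q = false)
    (hpq : (zeroGraph G η B s).Reachable (s, p) (s, q)) :
    HasNoisyPassage G B s p q ((zeroGraph G η B s).Reachable (s, p)) := by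
  induction s generalizing p q with
  | zero => simp [h0] at hp
  | succ s ih =>
    by_cases hpB : (s + 1, p) ∈ B
    · have := eq_of_reachable_of_mem hpB hpq
      simp only [Prod.mk.injEq, true_and] at this
      subst this
      exact ⟨.nil, {(s + 1, q)}, by simpa using hpB, by simp, by simp, by simp⟩
    have hqB : (s + 1, q) ∉ B := by
      intro hqB
      have := eq_of_reachable_of_mem hqB hpq.symm
      exact hpB (this ▸ hqB)
    obtain ⟨p', hpp', hp', hd'⟩ : ∃ p', G.Adj p p' ∧ η s p' = false ∧
        G.dist p' q = G.dist p q + 1 := by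
      obtain ⟨y, z, hyz, hy, hz⟩ := h2 s (by omega) p hp hpB
      rcases dist_eq_add_one_or_of_ne hG hy.1 hz.1 hyz q with h | h
      · exact ⟨y, hy.1, hy.2, h⟩
      · exact ⟨z, hz.1, hz.2, h⟩
    obtain ⟨q', hqq', hq', hd''⟩ : ∃ q', G.Adj q q' ∧ η s q' = false ∧
        G.dist p' q' = G.dist p' q + 1 := by
      obtain ⟨y, z, hyz, hy, hz⟩ := h2 s (by omega) q hq hqB
      rw [G.dist_comm (u := p') (v := q)]
      rcases dist_eq_add_one_or_of_ne hG hy.1 hz.1 hyz p' with h | h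
      · exact ⟨y, hy.1, hy.2, by rw [G.dist_comm, h]⟩
      · exact ⟨z, hz.1, hz.2, by rw [G.dist_comm, h]⟩
    have hp1 : (zeroGraph G η B (s + 1)).Adj (s + 1, p) (s, p') :=
      Or.inl ⟨rfl, le_rfl, hpp', hp, hp', hpB⟩
    have hq1 : (zeroGraph G η B (s + 1)).Adj (s + 1, q) (s, q') :=
      Or.inl ⟨rfl, le_rfl, hqq', hq, hq', hqB⟩
    obtain ⟨π, hπ⟩ := (forkGraph_reachable_of_reachable
      (hp1.reachable.symm.trans (hpq.trans hq1.reachable))).exists_isPath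
    obtain ⟨w, S, hSB, hSw, hSR, hl⟩ := hasNoisyPassage_of_forkGraph_path hG
      (fun p q => ih (by omega) p q) π hπ p' q' hp' hq' rfl rfl
    have hp2 : (spaceTime G).Adj (s + 1, p) (s, p') := ⟨hpp', Or.inl rfl⟩
    have hq2 : (spaceTime G).Adj (s, q') (s + 1, q) := ⟨hqq'.symm, Or.inr rfl⟩
    refine ⟨.cons hp2 (w.append (.cons hq2 .nil)), S, hSB, ?_, ?_, ?_⟩
    · intro a ha
      rw [SimpleGraph.Walk.support_cons, List.mem_cons, SimpleGraph.Walk.mem_support_append_iff]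
      exact Or.inr (Or.inl (hSw a ha))
    · exact fun a ha => hp1.reachable.trans (hSR a ha).2
    · simp only [SimpleGraph.Walk.length_append, SimpleGraph.Walk.length_cons,
        SimpleGraph.Walk.length_nil]
      omega

theorem hasNoisyWalk_of_isTree [G.LocallyFinite] (hG : G.IsTree) {j : ℕ}
    (hd : ∀ x, j < G.degree x) (t : ℕ) (η : ℕ → Config V) (B : Set (ℕ × V))
    (h : ZeroRule G j t η B) (x : V) (hx : η t x = false) :
    HasNoisyWalk (spaceTime G) 4 B (t, x) := by
  obtain ⟨w, S, h1, h2, -, h4⟩ := hasNoisyPassage_of_reachable (G := G) (η := η) (B := B) hG h.1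
    (fun s hs x hx hxB => by
      have h1 := (h.2 s hs x hx).resolve_left hxB
      have h2 := Finset.card_filter_add_card_filter_not (s := G.neighborFinset x)
        (fun z => η s z = true)
      rw [SimpleGraph.card_neighborFinset_eq_degree] at h2
      rw [onesAround] at h1
      have h3 := hd x
      obtain ⟨y, hy, z, hz, hyz⟩ := Finset.one_lt_card.1
        (show 1 < ((G.neighborFinset x).filter fun z => ¬ η s z = true).card by omega)
      exact ⟨y, z, hyz, by simpa using hy, by simpa using hz⟩)
    t le_rfl x x hx hx (SimpleGraph.Reachable.refl _)
  exact ⟨_, w, S, h1, h2, by omega⟩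

end Tree

/-! ## Good thresholds -/

theorem ChiGood.exists_hasNoisyWalk {V : Type*} {G : SimpleGraph V} [G.LocallyFinite]
    (hdeg : BddAbove (Set.range fun x => G.degree x)) {j : ℕ} (hj : ChiGood G j) :
    ∃ k : ℕ, ∀ (t : ℕ) (η : ℕ → Config V) (B : Set (ℕ × V)),
      ZeroRule G j t η B → ∀ x, η t x = false → HasNoisyWalk (spaceTime G) k B (t, x) := by
  obtain ⟨hj1, hjδ, hgood⟩ := hj
  have hδ : ∀ x, j ≤ G.degree x := fun x => hjδ.trans (ciInf_le (OrderBot.bddBelow _) x)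
  have hΔ : ∀ x, G.degree x ≤ supDegree G := fun x => le_ciSup hdeg x
  rcases hgood with h | ⟨-, h⟩ | h | ⟨d, -, hT, hreg, hjd⟩
  · rcases isEmpty_or_nonempty V with hV | ⟨⟨x⟩⟩
    · exact ⟨0, fun _ _ _ _ x => (hV.false x).elim⟩
    -- Since `Φ_E ≤ deg x ≤ Δ`, the inequality `2j < 3Φ_E - Δ + 2` implies `j < Φ_E + 1`.
    · refine hasNoisyWalk_of_lt_edgeExpansion hΔ hδ ?_
      have h1 := edgeExpansion_le_degree (G := G) x
      have h2 : (G.degree x : ℝ) ≤ supDegree G := by exact_mod_cast hΔ x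
      linarith
  · exact hasNoisyWalk_of_lt_edgeExpansion hΔ hδ h
  · exact hasNoisyWalk_of_lt_vertexExpansion hj1 h
  · exact ⟨4, hasNoisyWalk_of_isTree hT fun x => by rw [hreg x]; exact hjd⟩

/-! ## Estimates on the noise -/

section Noise

variable {V : Type*}

theorem measurableSet_apply_eq (x : V) (b : Bool) : MeasurableSet {η : Config V | η x = b} :=
  measurableSet_eq_fun (measurable_pi_apply x) measurable_const

theorem volume_lt_le (ε : ℝ) : (volume : Measure I) {u | (u : ℝ) < ε} ≤ ENNReal.ofReal ε := by
  rw [unitInterval.volume_apply]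
  refine (measure_mono (t := Set.Ico 0 ε) ?_).trans (by rw [Real.volume_Ico, sub_zero])
  rintro _ ⟨u, hu, rfl⟩
  exact ⟨u.2.1, hu⟩

theorem measurableSet_lt_unitInterval (ε : ℝ) : MeasurableSet {u : I | (u : ℝ) < ε} :=
  measurableSet_lt measurable_subtype_coe measurable_const

/-- The reindexing `g` serves both time directions: the identity for the forward process and `s ↦ n
- s` for the backward one, the latter injective only on times up to `n`. -/
theorem noiseLaw_forall_lt_le (ε : ℝ) (D : Set (ℕ × V)) (g : ℕ × V → ℕ × V) (hg : Set.InjOn g D)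
    (S : Finset (ℕ × V)) :
    noiseLaw V {L | ∀ a ∈ S, a ∈ {b | b ∈ D ∧ (L (g b) : ℝ) < ε}} ≤
      ENNReal.ofReal ε ^ S.card := by
  classical
  by_cases hSD : ∀ a ∈ S, a ∈ D
  · have hsub : {L : ℕ × V → I | ∀ a ∈ S, a ∈ {b | b ∈ D ∧ (L (g b) : ℝ) < ε}} ⊆
        Set.pi (S.image g : Finset (ℕ × V)) fun _ => {u : I | (u : ℝ) < ε} := by
      intro L hL b hb
      obtain ⟨a, ha, rfl⟩ := Finset.mem_image.1 (Finset.mem_coe.1 hb)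
      exact (hL a ha).2
    refine (measure_mono hsub).trans ?_
    rw [noiseLaw, Measure.infinitePi_pi _ fun _ _ => measurableSet_lt_unitInterval ε,
      Finset.prod_const, Finset.card_image_of_injOn fun a ha b hb => hg (hSD a ha) (hSD b hb)]
    exact pow_le_pow_left' (volume_lt_le ε) _
  · push Not at hSD
    obtain ⟨a, ha, haD⟩ := hSD
    have : {L : ℕ × V → I | ∀ a ∈ S, a ∈ {b | b ∈ D ∧ (L (g b) : ℝ) < ε}} = ∅ :=
      Set.eq_empty_of_forall_notMem fun L hL => haD (hL a ha).1
    rw [this, measure_empty]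
    exact zero_le

/-- The noise obtained by inserting `u` at time `0` and delaying `L` by one time step. -/
def consNoise (p : (V → I) × (ℕ × V → I)) : ℕ × V → I := fun a =>
  Nat.casesOn a.1 (p.1 a.2) fun n => p.2 (n, a.2)

theorem measurable_consNoise : Measurable (consNoise (V := V)) := by
  refine measurable_pi_iff.2 ?_
  rintro ⟨n, x⟩
  cases n with
  | zero => exact (measurable_pi_apply x).comp measurable_fst
  | succ n => exact (measurable_pi_apply (n, x)).comp measurable_snd

theorem map_consNoise_prod :
    ((stepNoiseLaw V).prod (noiseLaw V)).map consNoise = noiseLaw V := by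
  classical
  refine Measure.eq_infinitePi _ fun S T hT => ?_
  set S₀ : Finset V := (S.filter fun a => a.1 = 0).image Prod.snd with hS₀
  set S₁ : Finset (ℕ × V) := (S.filter fun a => ¬ a.1 = 0).image fun a => (a.1 - 1, a.2) with hS₁
  have hpre : consNoise ⁻¹' (Set.pi S T) =
      (Set.pi (S₀ : Set V) fun x => T (0, x)) ×ˢ
        (Set.pi (S₁ : Set (ℕ × V)) fun a => T (a.1 + 1, a.2)) := by
    ext ⟨u, L⟩
    simp only [Set.mem_preimage, Set.mem_pi, Set.mem_prod, Finset.mem_coe, hS₀, hS₁,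
      Finset.mem_image, Finset.mem_filter]
    constructor
    · intro h
      refine ⟨?_, ?_⟩
      · rintro _ ⟨⟨n, x⟩, ⟨ha, hn⟩, rfl⟩
        simp only at hn
        subst hn
        exact h _ ha
      · rintro _ ⟨⟨n, x⟩, ⟨ha, hn⟩, rfl⟩
        obtain ⟨m, rfl⟩ := Nat.exists_eq_succ_of_ne_zero hn
        exact h _ ha
    · rintro ⟨h1, h2⟩ ⟨n, x⟩ ha
      cases n with
      | zero => exact h1 x ⟨_, ⟨ha, rfl⟩, rfl⟩
      | succ m => exact h2 (m, x) ⟨_, ⟨ha, by simp⟩, by simp⟩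
  rw [Measure.map_apply measurable_consNoise (.pi S.countable_toSet fun i _ => hT i), hpre,
    Measure.prod_prod, stepNoiseLaw, noiseLaw, Measure.infinitePi_pi _ fun _ _ => hT _,
    Measure.infinitePi_pi _ fun _ _ => hT _, ← Finset.prod_filter_mul_prod_filter_not S
      fun a => a.1 = 0, hS₀, hS₁, Finset.prod_image, Finset.prod_image]
  · congr 1
    · refine Finset.prod_congr rfl ?_
      rintro ⟨n, x⟩ ha
      have hn : n = 0 := (Finset.mem_filter.1 ha).2
      rw [hn]
    · refine Finset.prod_congr rfl ?_
      rintro ⟨n, x⟩ ha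
      have hn : n ≠ 0 := (Finset.mem_filter.1 ha).2
      simp only
      rw [Nat.sub_add_cancel (Nat.one_le_iff_ne_zero.2 hn)]
  · rintro ⟨n, x⟩ ha ⟨m, y⟩ hb hab
    simp only [Finset.coe_filter, Set.mem_ofPred_eq, Prod.mk.injEq] at ha hb hab
    ext
    · simp only; omega
    · exact hab.2
  · rintro ⟨n, x⟩ ha ⟨m, y⟩ hb hab
    simp only [Finset.coe_filter, Set.mem_ofPred_eq] at ha hb hab
    ext
    · simp only; omega
    · exact hab

end Noise

/-! ## Monotone local dynamics -/

section Rule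

variable {V : Type*} (G : SimpleGraph V) [G.LocallyFinite]

/-- A measurable, monotone, local update rule for which a vertex in state `0` is either noisy or
had fewer than `j` ones around it. -/
structure IsThresholdRule (j : ℕ) (ε : ℝ) (f : Config V → (V → I) → Config V) : Prop where
  measurable : Measurable fun p : Config V × (V → I) => f p.1 p.2
  monotone : ∀ u, Monotone fun η => f η u
  local' : ∀ η η' u x, η x = η' x → (∀ y ∈ G.neighborFinset x, η y = η' y) → f η u x = f η' u x
  zero : ∀ η u x, f η u x = false → (u x : ℝ) < ε ∨ onesAround G η x < j

/-- The process with update rule `f` started from `ξ`. -/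
def run (f : Config V → (V → I) → Config V) (ξ : Config V) (u : ℕ → V → I) : ℕ → Config V
  | 0 => ξ
  | t + 1 => f (run f ξ u t) (u (t + 1))

/-- The state at time `0` of the process with update rule `f` started from all ones `n` steps
earlier, where `L (s, ·)` is the noise used in the last step but `s`. -/
def runBack (f : Config V → (V → I) → Config V) : ℕ → (ℕ × V → I) → Config V
  | 0, _ => fun _ => true
  | n + 1, L => f (runBack f n fun a => L (a.1 + 1, a.2)) fun x => L (0, x)

/-- The limit of `runBack f n` for monotone `f`. -/
def runLimit (f : Config V → (V → I) → Config V) (L : ℕ × V → I) : Config V := fun x =>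
  open Classical in decide (∀ n, runBack f n L x = true)

variable {G} {j : ℕ} {ε : ℝ} {f : Config V → (V → I) → Config V}

omit [G.LocallyFinite] in
theorem run_congr (ξ : Config V) {u v : ℕ → V → I} {t : ℕ} (h : ∀ s ≤ t, u s = v s) :
    run f ξ u t = run f ξ v t := by
  induction t with
  | zero => rfl
  | succ t ih => rw [run, run, ih fun s hs => h s (by omega), h (t + 1) le_rfl]

theorem runBack_eq_run (n : ℕ) (L : ℕ × V → I) :
    runBack f n L = run f (fun _ => true) (fun s x => L (n - s, x)) n := by
  induction n generalizing L with
  | zero => rfl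
  | succ n ih =>
    rw [runBack, run, ih, Nat.sub_self]
    congr 1
    refine run_congr _ fun s hs => ?_
    rw [Nat.succ_sub hs]

theorem IsThresholdRule.zeroRule (hf : IsThresholdRule G j ε f) (t : ℕ) (u : ℕ → V → I)
    (B : Set (ℕ × V)) (hB : ∀ s < t, ∀ x, (u (s + 1) x : ℝ) < ε → (s + 1, x) ∈ B) :
    ZeroRule G j t (run f (fun _ => true) u) B :=
  ⟨fun _ => rfl, fun s hs x hx => (hf.zero _ _ x hx).imp_left (hB s hs x)⟩

/-- Starting one step earlier amounts to starting at the same time from a configuration below all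
ones, and monotonicity preserves the order. -/
theorem IsThresholdRule.runBack_succ_le (hf : IsThresholdRule G j ε f) (n : ℕ) (L : ℕ × V → I) :
    runBack f (n + 1) L ≤ runBack f n L := by
  induction n generalizing L with
  | zero => exact fun x => Bool.le_true _
  | succ n ih => exact hf.monotone _ (ih _)

theorem IsThresholdRule.antitone_runBack (hf : IsThresholdRule G j ε f) (L : ℕ × V → I) :
    Antitone fun n => runBack f n L :=
  antitone_nat_of_succ_le fun n => hf.runBack_succ_le n L

theorem IsThresholdRule.eventually_runBack_eq (hf : IsThresholdRule G j ε f) (L : ℕ × V → I)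
    (x : V) : ∀ᶠ n in Filter.atTop, runBack f n L x = runLimit f L x := by
  by_cases h : ∀ n, runBack f n L x = true
  · exact Filter.Eventually.of_forall fun n => by rw [h n, runLimit]; simp [h]
  · have h1 : runLimit f L x = false := by rw [runLimit]; simpa using h
    push Not at h
    obtain ⟨N, hN⟩ := h
    filter_upwards [Filter.eventually_ge_atTop N] with n hn
    have h2 : runBack f n L x ≤ runBack f N L x := hf.antitone_runBack L hn x
    rw [Bool.eq_false_of_not_eq_true hN] at h2
    rw [h1]
    exact Bool.eq_false_of_le_false h2

/-- Locality replaces continuity: the update at `x` reads finitely many vertices, and all of them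
have reached their limits at a common large `n`. -/
theorem IsThresholdRule.runLimit_eq (hf : IsThresholdRule G j ε f) (L : ℕ × V → I) :
    runLimit f L = f (runLimit f fun a => L (a.1 + 1, a.2)) fun x => L (0, x) := by
  funext x
  have h1 := (Filter.tendsto_add_atTop_nat 1).eventually (hf.eventually_runBack_eq L x)
  have h2 := hf.eventually_runBack_eq (fun a => L (a.1 + 1, a.2)) x
  have h3 := (Filter.eventually_all_finset (G.neighborFinset x)).2 fun y _ =>
    hf.eventually_runBack_eq (fun a => L (a.1 + 1, a.2)) y
  obtain ⟨n, hn1, hn2, hn3⟩ := (h1.and (h2.and h3)).exists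
  rw [← hn1, runBack]
  exact hf.local' _ _ _ x hn2 hn3

theorem IsThresholdRule.measurable_runBack (hf : IsThresholdRule G j ε f) (n : ℕ) :
    Measurable (runBack f n) := by
  induction n with
  | zero => exact measurable_const
  | succ n ih =>
    have h1 : Measurable fun (L : ℕ × V → I) (a : ℕ × V) => L (a.1 + 1, a.2) :=
      measurable_pi_iff.2 fun a => measurable_pi_apply _
    have h2 : Measurable fun (L : ℕ × V → I) (x : V) => L (0, x) :=
      measurable_pi_iff.2 fun x => measurable_pi_apply _
    exact hf.measurable.comp ((ih.comp h1).prodMk h2)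

theorem IsThresholdRule.measurable_runLimit (hf : IsThresholdRule G j ε f) :
    Measurable (runLimit f) := by
  refine measurable_pi_iff.2 fun x => measurable_to_bool ?_
  have : (fun L => runLimit f L x) ⁻¹' {true} = ⋂ n, (fun L => runBack f n L x) ⁻¹' {true} := by
    ext L
    simp [runLimit]
  rw [this]
  exact MeasurableSet.iInter fun n =>
    ((measurable_pi_apply x).comp (hf.measurable_runBack n)) (measurableSet_singleton _)

/-- Inserting a fresh noise layer in front preserves the noise law, and by `runLimit_eq` it applies
one update to the limit configuration. -/
theorem IsThresholdRule.map_prod_map_runLimit (hf : IsThresholdRule G j ε f) :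
    (((noiseLaw V).map (runLimit f)).prod (stepNoiseLaw V)).map (fun p => f p.1 p.2) =
      (noiseLaw V).map (runLimit f) := by
  have hm := hf.measurable_runLimit
  have h1 : (runLimit f ∘ consNoise) = fun p : (V → I) × (ℕ × V → I) => f (runLimit f p.2) p.1 := by
    funext p
    exact hf.runLimit_eq _
  conv_rhs => rw [← map_consNoise_prod, Measure.map_map hm measurable_consNoise, h1]
  have h2 : ((noiseLaw V).map (runLimit f)).prod (stepNoiseLaw V) =
      ((stepNoiseLaw V).prod (noiseLaw V)).map fun p => (runLimit f p.2, p.1) := by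
    rw [← Measure.prod_swap (μ := noiseLaw V), Measure.map_map (by fun_prop) measurable_swap]
    conv_lhs => rw [← Measure.map_id (μ := stepNoiseLaw V)]
    rw [Measure.map_prod_map _ _ hm measurable_id]
    rfl
  rw [h2, Measure.map_map hf.measurable (by fun_prop)]
  rfl

/-- If the threshold is good and the noise is small, then zeros are unlikely in the process started
from all ones, and the process has an invariant law under which zeros are unlikely. -/
theorem exists_forall_isThresholdRule (hdeg : BddAbove (Set.range fun x => G.degree x))
    (hj : ChiGood G j) : ∃ ε₀ : ℝ, 0 < ε₀ ∧ ∀ ε ≤ ε₀, ∀ f, IsThresholdRule G j ε f →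
      (∀ t x, noiseLaw V {L | run f (fun _ => true) (fun s x => L (s, x)) t x = false} ≤ 1 / 4) ∧
      ∃ μ : Measure (Config V), IsProbabilityMeasure μ ∧
        (μ.prod (stepNoiseLaw V)).map (fun p => f p.1 p.2) = μ ∧
        ∀ x, μ {η | η x = false} ≤ 1 / 4 := by
  obtain ⟨k, hk⟩ := hj.exists_hasNoisyWalk hdeg
  obtain ⟨ε₀, hε₀, hP⟩ := exists_measure_hasNoisyWalk_le_quarter (2 * supDegree G) k
  refine ⟨ε₀, hε₀, fun ε hε f hf => ?_⟩
  have hP' := fun (B : (ℕ × V → I) → Set (ℕ × V)) hB => hP (noiseLaw V) (spaceTime G)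
    (spaceTimeNbrs G) (mem_spaceTimeNbrs G)
    (card_spaceTimeNbrs_le G fun x => le_ciSup hdeg x) B ε hε hB
  refine ⟨fun t x => ?_, (noiseLaw V).map (runLimit f),
    Measure.isProbabilityMeasure_map hf.measurable_runLimit.aemeasurable,
    hf.map_prod_map_runLimit, fun x => ?_⟩
  · refine (measure_mono fun L hL => ?_).trans
      (hP' _ (noiseLaw_forall_lt_le ε Set.univ id Function.injective_id.injOn) (t, x))
    exact hk t _ {b | b ∈ Set.univ ∧ (L (id b) : ℝ) < ε} (hf.zeroRule t _ _ fun s _ y hy => ⟨trivial, hy⟩) x hL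
  · rw [Measure.map_apply hf.measurable_runLimit (measurableSet_apply_eq x false)]
    have hU : runLimit f ⁻¹' {η : Config V | η x = false} =
        ⋃ n, {L | runBack f n L x = false} := by
      ext L
      simp [runLimit]
    have hmono : Monotone fun n => {L | runBack f n L x = false} := by
      intro m n hmn L hL
      have h1 : runBack f n L x ≤ runBack f m L x := hf.antitone_runBack L hmn x
      rw [Set.mem_ofPred_eq] at hL ⊢
      rw [hL] at h1
      exact Bool.eq_false_of_le_false h1
    rw [hU, hmono.measure_iUnion]
    -- The limit is zero at `x` exactly when some finite backward run is; these events increase with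
    -- `n`, so the uniform bound passes to the union. Each backward run is a forward run with
    -- time-reversed noise.
    refine iSup_le fun n => (measure_mono fun L hL => ?_).trans
      (hP' _ (noiseLaw_forall_lt_le ε {a | a.1 ≤ n} (fun a => (n - a.1, a.2)) ?_) (n, x))
    · rw [Set.mem_ofPred_eq, runBack_eq_run] at hL
      exact hk n _ {b | b ∈ {a : ℕ × V | a.1 ≤ n} ∧ (L (n - b.1, b.2) : ℝ) < ε} (hf.zeroRule n _ _ fun s hs y hy => ⟨hs, hy⟩) x hL
    · rintro ⟨a, y⟩ ha ⟨b, z⟩ hb hab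
      simp only [Set.mem_ofPred_eq, Prod.mk.injEq] at ha hb hab
      ext
      · simp only; omega
      · exact hab.2

end Rule

/-! ## The two dynamics as threshold rules -/

section Dynamics

variable {V : Type*} {G : SimpleGraph V} [G.LocallyFinite]

theorem onesAround_mono {η η' : Config V} (h : η ≤ η') (x : V) :
    onesAround G η x ≤ onesAround G η' x :=
  Finset.card_le_card (Finset.monotone_filter_right _ fun y _ hy => by
    have h1 := h y
    rw [hy] at h1
    exact Bool.eq_true_of_true_le h1)

theorem onesAround_congr {η η' : Config V} {x : V} (h : ∀ y ∈ G.neighborFinset x, η y = η' y) :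
    onesAround G η x = onesAround G η' x := by
  unfold onesAround
  rw [Finset.filter_congr fun y hy => by rw [h y hy]]

theorem onesAround_add_onesAround_not (η : Config V) (x : V) :
    onesAround G η x + onesAround G (fun y => !η y) x = G.degree x := by
  rw [← SimpleGraph.card_neighborFinset_eq_degree,
    ← Finset.card_filter_add_card_filter_not (s := G.neighborFinset x) (fun y => η y = true)]
  simp [onesAround]

theorem isThresholdRule_consensusStep (j : ℕ) (ε : ℝ) :
    IsThresholdRule G j ε (consensusStep G j ε) where
  measurable := measurable_consensusStep G j ε
  monotone u η η' h x := by
    have := onesAround_mono (G := G) h x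
    simp only [consensusStep]
    split_ifs <;> first | exact le_rfl | exact Bool.false_le _ | omega
  local' η η' u x _ h := by
    simp only [consensusStep, onesAround_congr h]
  zero η u x h := by
    simp only [consensusStep] at h
    split_ifs at h with h1 h2
    · exact Or.inl h1
    · exact Or.inr (not_le.1 h2)

theorem majorityStep_mono (ε : ℝ) (u : V → I) : Monotone fun η => majorityStep G ε η u := by
  intro η η' h x
  have h1 : (onesAround G η x : ℝ) ≤ onesAround G η' x := by
    exact_mod_cast onesAround_mono (G := G) h x
  have h2 := h x
  simp only [majorityStep]
  split_ifs <;> first | exact le_rfl | exact Bool.false_le _ | exact Bool.le_true _ | exact h2 |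
    (exfalso; linarith)

theorem majorityStep_congr (ε : ℝ) {η η' : Config V} (u : V → I) {x : V} (hx : η x = η' x)
    (h : ∀ y ∈ G.neighborFinset x, η y = η' y) :
    majorityStep G ε η u x = majorityStep G ε η' u x := by
  simp only [majorityStep, onesAround_congr h, hx]

/-- This is why the threshold `D / 2 + 1` fits majority voting: that many ones around a vertex of
degree at most `D` form a strict majority. -/
theorem lt_half_add_one_of_two_mul_le {c d D : ℕ} (h : (c : ℝ) ≤ (d : ℝ) / 2) (hd : d ≤ D) :
    c < D / 2 + 1 := by
  have h1 : 2 * c ≤ d := by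
    have : (2 : ℝ) * c ≤ d := by linarith
    exact_mod_cast this
  omega

theorem isThresholdRule_majorityStep {ε : ℝ} (hε : 0 ≤ ε) {D : ℕ} (hD : ∀ x, G.degree x ≤ D) :
    IsThresholdRule G (D / 2 + 1) ε (majorityStep G ε) where
  measurable := measurable_majorityStep G ε
  monotone := majorityStep_mono ε
  local' _ _ u _ hx h := majorityStep_congr ε u hx h
  zero η u x h := by
    simp only [majorityStep] at h
    split_ifs at h with h1 h2 h3 h4
    · exact Or.inl (by linarith)
    · exact Or.inr (lt_half_add_one_of_two_mul_le h3.le (hD x))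
    · exact Or.inr (lt_half_add_one_of_two_mul_le (not_lt.1 h4) (hD x))

/-- Exchange of the two states. -/
def swapStates (η : Config V) : Config V := fun x => !η x

omit [G.LocallyFinite] in
theorem measurable_swapStates : Measurable (swapStates (V := V)) :=
  measurable_pi_iff.2 fun x => (measurable_of_countable _).comp (measurable_pi_apply x)

theorem swapStates_swapStates (η : Config V) : swapStates (swapStates η) = η := by
  funext x
  simp [swapStates]

/-- A zero of the swapped rule is a one of the original: either the noise is below `ε`, or at least
half of the neighbours were ones before the exchange, so at most half are ones after it. Ties fall
under the same threshold. -/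
theorem isThresholdRule_swapStates_majorityStep {ε : ℝ} {D : ℕ}
    (hD : ∀ x, G.degree x ≤ D) :
    IsThresholdRule G (D / 2 + 1) ε fun η u => swapStates (majorityStep G ε (swapStates η) u) where
  measurable := measurable_swapStates.comp ((measurable_majorityStep G ε).comp
    ((measurable_swapStates.comp measurable_fst).prodMk measurable_snd))
  monotone u η η' h x := by
    have h1 : swapStates η' ≤ swapStates η := fun y => by
      have := h y
      revert this
      simp only [swapStates]
      cases η y <;> cases η' y <;> simp
    have h2 : majorityStep G ε (swapStates η') u x ≤ majorityStep G ε (swapStates η) u x :=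
      majorityStep_mono ε u h1 x
    show (!majorityStep G ε (swapStates η) u x) ≤ !majorityStep G ε (swapStates η') u x
    revert h2
    generalize majorityStep G ε (swapStates η') u x = a
    generalize majorityStep G ε (swapStates η) u x = b
    cases a <;> cases b <;> simp
  local' η η' u x hx h := by
    exact congrArg not (majorityStep_congr ε u (congrArg not hx) fun y hy => congrArg not (h y hy))
  zero η u x h := by
    have hsum : (onesAround G η x : ℝ) + onesAround G (swapStates η) x = G.degree x := by
      exact_mod_cast onesAround_add_onesAround_not (G := G) η x
    rw [swapStates, Bool.not_eq_false'] at h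
    simp only [majorityStep] at h
    split_ifs at h with h1 h2 h3 h4
    · exact Or.inl h2
    · exact Or.inr (lt_half_add_one_of_two_mul_le (by linarith) (hD x))
    · exact Or.inr (lt_half_add_one_of_two_mul_le (by linarith) (hD x))

theorem consensus_eq_run (j : ℕ) (ε : ℝ) (ξ : Config V) (L : ℕ × V → I) (t : ℕ) :
    consensus G j ε ξ L t = run (consensusStep G j ε) ξ (fun s x => L (s, x)) t := by
  induction t with
  | zero => rfl
  | succ t ih => rw [consensus, run, ih]

theorem majority_eq_run (ε : ℝ) (ξ : Config V) (L : ℕ × V → I) (t : ℕ) :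
    majority G ε ξ L t = run (majorityStep G ε) ξ (fun s x => L (s, x)) t := by
  induction t with
  | zero => rfl
  | succ t ih => rw [majority, run, ih]

omit [G.LocallyFinite] in
theorem invariant_of_map_prod {κ : Kernel (Config V) (Config V)}
    {f : Config V → (V → I) → Config V} (hf : Measurable fun p : Config V × (V → I) => f p.1 p.2)
    (hκ : ∀ η, κ η = (stepNoiseLaw V).map (f η)) {μ : Measure (Config V)} [IsProbabilityMeasure μ]
    (hμ : (μ.prod (stepNoiseLaw V)).map (fun p => f p.1 p.2) = μ) : κ.Invariant μ := by
  rw [Kernel.Invariant]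
  conv_rhs => rw [← hμ]
  ext s hs
  rw [Measure.bind_apply hs κ.measurable.aemeasurable, Measure.map_apply hf hs,
    Measure.prod_apply (hf hs)]
  refine lintegral_congr fun η => ?_
  rw [hκ]
  exact Measure.map_apply (hf.comp measurable_prodMk_left) hs

/-- Noise creates only zeros, and `j ≥ 1` prevents a one from appearing without a neighbouring one,
so all zeros is absorbing. -/
theorem invariant_dirac_false {j : ℕ} (hj : 1 ≤ j) (ε : ℝ) :
    (consensusKernel G j ε).Invariant (Measure.dirac fun _ => false) := by
  rw [Kernel.Invariant, Measure.dirac_bind (consensusKernel G j ε).measurable]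
  show (stepNoiseLaw V).map (fun u => consensusStep G j ε (fun _ => false) u) = _
  have : (fun u => consensusStep G j ε (fun _ : V => false) u) = fun _ _ => false := by
    funext u x
    have h0 : onesAround G (fun _ => false) x = 0 := by simp [onesAround]
    simp only [consensusStep, h0]
    split_ifs <;> first | rfl | omega
  rw [this, Measure.map_const, measure_univ, one_smul]

omit [G.LocallyFinite] in
theorem ne_of_measure_le_quarter {μ ν : Measure (Config V)} [IsProbabilityMeasure μ] (x : V)
    (h₀ : μ {η | η x = false} ≤ 1 / 4) (h₁ : ν {η | η x = true} ≤ 1 / 4) : μ ≠ ν := by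
  rintro rfl
  have h : (1 : ENNReal) ≤ 1 / 4 + 1 / 4 := by
    calc (1 : ENNReal) = μ ({η | η x = false} ∪ {η | η x = true}) := by
          rw [← measure_univ (μ := μ)]
          congr 1
          ext η
          simp
      _ ≤ 1 / 4 + 1 / 4 := (measure_union_le _ _).trans (add_le_add h₀ h₁)
  have h4 : (1 : ENNReal) / 4 = ENNReal.ofReal (1 / 4) := by
    rw [ENNReal.ofReal_div_of_pos (by norm_num)]; norm_num
  rw [h4, ← ENNReal.ofReal_add (by norm_num) (by norm_num), ENNReal.one_le_ofReal] at h
  norm_num at h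

omit [G.LocallyFinite] in
theorem real_le_quarter {Ω : Type*} [MeasurableSpace Ω] {P : Measure Ω} {s : Set Ω}
    (h : P s ≤ 1 / 4) : P.real s ≤ 1 / 4 := by
  have := ENNReal.toReal_mono (by simp) h
  simpa [Measure.real] using this

end Dynamics

/-! ## Non-ergodicity -/

theorem consensus_nonergodic {V : Type*} [Infinite V] (G : SimpleGraph V) [G.LocallyFinite]
    (hdeg : BddAbove (Set.range fun x => G.degree x)) (j : ℕ) (hj : ChiGood G j) :
    ∃ ε₀ : ℝ, 0 < ε₀ ∧ ∀ ε : ℝ, 0 ≤ ε → ε ≤ ε₀ →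
      HasMultipleInvariantMeasures (consensusKernel G j ε) ∧
      ∃ c : ℝ, 0 < c ∧ c < 1 / 2 ∧ ∀ t : ℕ, 1 ≤ t → ∀ x : V,
        (noiseLaw V).real {L | consensus G j ε (fun _ => true) L t x = false} ≤ c := by
  obtain ⟨ε₀, hε₀, h⟩ := exists_forall_isThresholdRule hdeg hj
  refine ⟨ε₀, hε₀, fun ε _ hε => ?_⟩
  have hf := isThresholdRule_consensusStep (G := G) j ε
  obtain ⟨hrun, μ, hμ, hinv, hμx⟩ := h ε hε _ hf
  obtain ⟨x₀⟩ : Nonempty V := inferInstance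
  refine ⟨⟨μ, Measure.dirac fun _ => false, hμ, inferInstance,
    invariant_of_map_prod hf.measurable (fun η => rfl) hinv, invariant_dirac_false hj.1 ε,
    ne_of_measure_le_quarter x₀ (hμx x₀) ?_⟩, 1 / 4, by norm_num, by norm_num, fun t _ x => ?_⟩
  · rw [Measure.dirac_apply' _
      (measurableSet_apply_eq x₀ true)]
    simp
  · simp only [consensus_eq_run]
    exact real_le_quarter (hrun t x)

theorem majority_nonergodic {V : Type*} [Infinite V] (G : SimpleGraph V) [G.LocallyFinite]
    (hdeg : BddAbove (Set.range fun x => G.degree x)) (hj : ChiGood G (supDegree G / 2 + 1)) :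
    ∃ ε₀ : ℝ, 0 < ε₀ ∧ ∀ ε : ℝ, 0 ≤ ε → ε ≤ ε₀ →
      HasMultipleInvariantMeasures (majorityKernel G ε) ∧
      ∃ c : ℝ, 0 < c ∧ c < 1 / 2 ∧ ∀ t : ℕ, 1 ≤ t → ∀ x : V,
        (noiseLaw V).real {L | majority G ε (fun _ => true) L t x = false} ≤ c := by
  obtain ⟨ε₀, hε₀, h⟩ := exists_forall_isThresholdRule hdeg hj
  refine ⟨ε₀, hε₀, fun ε hε0 hε => ?_⟩
  have hΔ : ∀ x, G.degree x ≤ supDegree G := fun x => le_ciSup hdeg x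
  have hf := isThresholdRule_majorityStep (G := G) hε0 hΔ
  have hf' := isThresholdRule_swapStates_majorityStep (G := G) (ε := ε) hΔ
  obtain ⟨hrun, μ, hμ, hinv, hμx⟩ := h ε hε _ hf
  obtain ⟨-, ν, hν, hinv', hνx⟩ := h ε hε _ hf'
  obtain ⟨x₀⟩ : Nonempty V := inferInstance
  have hν' : IsProbabilityMeasure (ν.map swapStates) :=
    Measure.isProbabilityMeasure_map measurable_swapStates.aemeasurable
  -- The swapped rule is the majority rule conjugated by an involution, so exchanging states carries
  -- its invariant law to one of the majority rule.
  have hinv'' : ((ν.map swapStates).prod (stepNoiseLaw V)).map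
      (fun p => majorityStep G ε p.1 p.2) = ν.map swapStates := by
    conv_rhs => rw [← hinv', Measure.map_map measurable_swapStates hf'.measurable]
    conv_lhs => rw [← Measure.map_id (μ := stepNoiseLaw V)]
    rw [Measure.map_prod_map _ _ measurable_swapStates measurable_id,
      Measure.map_map hf.measurable (measurable_swapStates.prodMap measurable_id)]
    congr 1
    funext p
    exact (swapStates_swapStates _).symm
  refine ⟨⟨μ, ν.map swapStates, hμ, hν', invariant_of_map_prod hf.measurable (fun η => rfl) hinv,
    invariant_of_map_prod hf.measurable (fun η => rfl) hinv'',
    ne_of_measure_le_quarter x₀ (hμx x₀) ?_⟩, 1 / 4, by norm_num, by norm_num, fun t _ x => ?_⟩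
  · rw [Measure.map_apply measurable_swapStates
      (measurableSet_apply_eq x₀ true)]
    refine (measure_mono fun η hη => ?_).trans (hνx x₀)
    simpa [swapStates] using hη
  · simp only [majority_eq_run]
    exact real_le_quarter (hrun t x)

end NoisyDynamics

end

theorem theorem2p7 {V : Type*} [Infinite V] (G : SimpleGraph V) [G.LocallyFinite]
    (hconn : G.Connected) (hdeg : BddAbove (Set.range fun x => G.degree x)) :
    (∀ j : ℕ, NoisyDynamics.ChiGood G j →
      ∃ ε₀ : ℝ, 0 < ε₀ ∧ ∀ ε : ℝ, 0 ≤ ε → ε ≤ ε₀ →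
        NoisyDynamics.HasMultipleInvariantMeasures (NoisyDynamics.consensusKernel G j ε) ∧
        ∃ c : ℝ, 0 < c ∧ c < 1 / 2 ∧ ∀ t : ℕ, 1 ≤ t → ∀ x : V,
          (NoisyDynamics.noiseLaw V).real
            {L | NoisyDynamics.consensus G j ε (fun _ => true) L t x = false} ≤ c) ∧
    (NoisyDynamics.ChiGood G (NoisyDynamics.supDegree G / 2 + 1) →
      ∃ ε₀ : ℝ, 0 < ε₀ ∧ ∀ ε : ℝ, 0 ≤ ε → ε ≤ ε₀ →
        NoisyDynamics.HasMultipleInvariantMeasures (NoisyDynamics.majorityKernel G ε) ∧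
        ∃ c : ℝ, 0 < c ∧ c < 1 / 2 ∧ ∀ t : ℕ, 1 ≤ t → ∀ x : V,
          (NoisyDynamics.noiseLaw V).real
            {L | NoisyDynamics.majority G ε (fun _ => true) L t x = false} ≤ c) := by
  exact ⟨fun j hj => NoisyDynamics.consensus_nonergodic G hdeg j hj,
    fun hj => NoisyDynamics.majority_nonergodic G hdeg hj⟩
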